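/- Let $(V,B)$ be a nonzero finite-dimensional real symplectic vector space, $m=\dim V=2k$, let $\mathfrak{sp}(V)$ be the Lie algebra of endomorphisms $X$ of $V$ with $B(Xv,w)+B(v,Xw)=0$, and let $\mathbf i\in\mathbb C$ be a square root of $-1$. Let $d_V(v)=(2\pi)^{-k}|dx^1\cdots dx^m|$ be the Liouville integral, $(x^j)$ being the coordinates in a symplectic basis of $V$. The superPfaffian is the generalized function on $\mathfrak{sp}(V)$ $$\operatorname{Spf}(X)=\mathbf i^{m/2}\int_V d_V(v)\,\exp\!\big(-\tfrac{\mathbf i}{2}B(v,Xv)\big),$$ that is, for $\psi\in C_c^\infty(\mathfrak{sp}(V),\mathbb C)$ and a Haar measure $dX$ on $\mathfrak{sp}(V)$, $$\int \psi(X)\operatorname{Spf}(X)\,dX=\mathbf i^{m/2}\int_V d_V(v)\int_{\mathfrak{sp}(V)}\psi(X)\exp\!\big(-\tfrac{\mathbf i}{2}B(v,Xv)\big)dX .$$ Let $\tilde\mu:V\to\mathfrak{sp}(V)^*$, $\tilde\mu(v)(X)=-\tfrac12B(v,Xv)$, be the moment map and $\Omega=\tilde\mu(V)\setminus\{0\}$.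 Then: (a) $\Omega$ is a nilpotent coadjoint orbit of $Sp(V)$, and it is minimal, for the closure ordering, among the nilpotent coadjoint orbits other than $\{0\}$. It is a submanifold of $\mathfrak{sp}(V)^*$ of dimension $m$; let $\omega_\Omega$ be its canonical symplectic form, $\omega_\Omega(\operatorname{ad}^*_X f,\operatorname{ad}^*_Y f)=f([X,Y])$, and $|\omega_\Omega^{k}|/k!$ its Liouville measure. (b) $\tilde\mu^{-1}(\Omega)=V\setminus\{0\}$, the map $\tilde\mu:V\setminus\{0\}\to\Omega$ is a covering with two sheets, and $\tilde\mu^*\omega_\Omega=B$ on $V\setminus\{0\}$. (c) Let $$\mathcal F_\Omega(X)=\frac1{(2\pi)^{m/2}}\int_\Omega\exp\!\big(\mathbf i(f(X)+\omega_\Omega)\big)$$ be the Fourier transform of $\Omega$, oriented by $\omega_\Omega^{k}$ ($f$ denotes the point of $\Omega$, and one integrates the component of degree $m$); that is, $$\int\psi(X)\mathcal F_\Omega(X)\,dX=\frac{\mathbf i^{k}}{(2\pi)^{k}}\int_\Omega\Big(\int_{\mathfrak{sp}(V)}\psi(X)e^{\mathbf i f(X)}dX\Big)\frac{|\omega_\Omega^{k}|}{k!}(f).$$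 Both $\operatorname{Spf}$ and $\mathcal F_\Omega$ are well-defined generalized functions on $\mathfrak{sp}(V)$ (the outer integrals converge absolutely and define continuous functionals of $\psi$), the first one does not depend on the symplectic basis, and $$\operatorname{Spf}=2\,\mathcal F_\Omega .$$ -/

import Mathlib

set_option maxSynthPendingDepth 3

open scoped ContDiff Distributions

noncomputable section

namespace SpOrbit

variable {V : Type*} [NormedAddCommGroup V] [NormedSpace ℝ V]

/-! ### The symplectic Lie algebra, its dual and the coadjoint action -/

/-- The symplectic Lie algebra `sp(V)` of a bilinear form `B`: endomorphisms `X` of `V` with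
`B (X v) w + B v (X w) = 0`, as a subspace of the space of endomorphisms. -/
def sp (B : LinearMap.BilinForm ℝ V) : Submodule ℝ (V →L[ℝ] V) where
  carrier := {X | ∀ v w, B (X v) w + B v (X w) = 0}
  zero_mem' := by intro v w; simp
  add_mem' := by
    intro X Y hX hY v w
    have h1 := hX v w
    have h2 := hY v w
    simp only [add_apply, map_add, LinearMap.add_apply]
    linarith
  smul_mem' := by
    intro c X hX v w
    have h1 := hX v w
    simp only [smul_apply, map_smul, LinearMap.smul_apply, smul_eq_mul]
    linear_combination c * h1

/-- The dual space `sp(V)^*`. -/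
abbrev spDual (B : LinearMap.BilinForm ℝ V) : Type _ := sp B →L[ℝ] ℝ

theorem commutator_mem {B : LinearMap.BilinForm ℝ V} (X Y : sp B) :
    (X : V →L[ℝ] V) * (Y : V →L[ℝ] V) - (Y : V →L[ℝ] V) * (X : V →L[ℝ] V) ∈ sp B := by
  intro v w
  have h1 := X.2 (Y.1 v) w
  have h2 := Y.2 v (X.1 w)
  have h3 := Y.2 (X.1 v) w
  have h4 := X.2 v (Y.1 w)
  simp only [sub_apply, mul_apply_eq_comp, map_sub,
    LinearMap.sub_apply]
  linarith

/-- The adjoint representation `ad X Y = [X, Y] = X Y - Y X` of `sp(V)`. -/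
def ad {B : LinearMap.BilinForm ℝ V} (X : sp B) : sp B →L[ℝ] sp B :=
  ((ContinuousLinearMap.mul ℝ (V →L[ℝ] V) (X : V →L[ℝ] V)
      - (ContinuousLinearMap.mul ℝ (V →L[ℝ] V)).flip (X : V →L[ℝ] V)).comp
    (sp B).subtypeL).codRestrict (sp B) (fun Y => commutator_mem X Y)

theorem ad_coe {B : LinearMap.BilinForm ℝ V} (X Y : sp B) :
    ((ad X Y : sp B) : V →L[ℝ] V) = (X : V →L[ℝ] V) * Y - (Y : V →L[ℝ] V) * X := rfl

theorem ad_antisymm {B : LinearMap.BilinForm ℝ V} (X Y : sp B) : ad X Y = -ad Y X := by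
  apply Subtype.ext
  simp [ad_coe]

/-- The coadjoint representation: `(coad X f) Y = -f [X, Y]`. -/
def coad {B : LinearMap.BilinForm ℝ V} (X : sp B) (f : spDual B) : spDual B := -(f.comp (ad X))

/-- The symplectic group `Sp(V)`. -/
def Sp (B : LinearMap.BilinForm ℝ V) : Subgroup (V ≃L[ℝ] V) where
  carrier := {g | ∀ v w, B (g v) (g w) = B v w}
  one_mem' := by intro v w; rfl
  mul_mem' := by
    intro g h hg hh v w
    exact (hg (h v) (h w)).trans (hh v w)
  inv_mem' := by
    intro g hg v w
    have h1 := hg (g.symm v) (g.symm w)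
    rw [g.apply_symm_apply, g.apply_symm_apply] at h1
    exact h1.symm

/-- The adjoint action `Ad g X = g X g⁻¹` of `Sp(V)` on `sp(V)`. -/
def Ad {B : LinearMap.BilinForm ℝ V} (g : Sp B) (X : sp B) : sp B :=
  ⟨((g : V ≃L[ℝ] V) : V →L[ℝ] V).comp
      ((X : V →L[ℝ] V).comp ((g : V ≃L[ℝ] V).symm : V →L[ℝ] V)), by
    intro v w
    have hg := g.2
    have h1 := X.2 (g.1.symm v) (g.1.symm w)
    rw [← hg, ← hg (g.1.symm v), g.1.apply_symm_apply, g.1.apply_symm_apply] at h1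
    exact h1⟩

/-- The coadjoint orbit of `f`: all functionals `f' = f ∘ Ad g⁻¹` with `g ∈ Sp(V)`. -/
def coadjointOrbit {B : LinearMap.BilinForm ℝ V} (f : spDual B) : Set (spDual B) :=
  {f' | ∃ g : Sp B, ∀ X, f' (Ad g X) = f X}

/-- A functional on `sp(V)` is nilpotent when it is `Y ↦ tr (X Y)` for a nilpotent `X ∈ sp(V)`
(the trace form is the invariant form that identifies `sp(V)` with its dual). -/
def IsNilpotentFunctional {B : LinearMap.BilinForm ℝ V} (f : spDual B) : Prop :=
  ∃ X : sp B, IsNilpotent (X : V →L[ℝ] V) ∧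
    ∀ Y : sp B, f Y =
      LinearMap.trace ℝ V (((X : V →L[ℝ] V) * (Y : V →L[ℝ] V) : V →L[ℝ] V) : V →ₗ[ℝ] V)

/-- A nilpotent coadjoint orbit. -/
def IsNilpotentOrbit {B : LinearMap.BilinForm ℝ V} (O : Set (spDual B)) : Prop :=
  ∃ f : spDual B, IsNilpotentFunctional f ∧ O = coadjointOrbit f

/-- A minimal nilpotent coadjoint orbit: minimal among the nilpotent coadjoint orbits other than
`{0}`, for the closure ordering. -/
def IsMinimalNilpotentOrbit {B : LinearMap.BilinForm ℝ V} (O : Set (spDual B)) : Prop :=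
  IsNilpotentOrbit O ∧ O ≠ {0} ∧
    ∀ O' : Set (spDual B), IsNilpotentOrbit O' → O' ≠ {0} → O' ⊆ closure O → O' = O

/-! ### The symplectic form of a coadjoint orbit -/

open Classical in
/-- The symplectic (Kirillov-Kostant-Souriau) form of the coadjoint orbit through `f`, on the
tangent space `{coad X f}`: it sends `(coad X f, coad Y f)` to `f [X, Y]`. It is given the value
`0` when one of the two vectors is not tangent to the orbit. -/
def kksForm {B : LinearMap.BilinForm ℝ V} (f a b : spDual B) : ℝ :=
  if h : ∃ p : sp B × sp B, coad p.1 f = a ∧ coad p.2 f = b then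
    f (ad h.choose.1 h.choose.2)
  else 0

/-- The form is well defined. -/
theorem kksForm_coad {B : LinearMap.BilinForm ℝ V} (f : spDual B) (X Y : sp B) :
    kksForm f (coad X f) (coad Y f) = f (ad X Y) := by
  have h : ∃ p : sp B × sp B, coad p.1 f = coad X f ∧ coad p.2 f = coad Y f :=
    ⟨(X, Y), rfl, rfl⟩
  have key : ∀ P Q Z : sp B, coad P f = coad Q f → f (ad P Z) = f (ad Q Z) := by
    intro P Q Z hPQ
    have := DFunLike.congr_fun hPQ Z
    simpa [coad] using this
  rw [kksForm, dif_pos h]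
  obtain ⟨h1, h2⟩ := h.choose_spec
  rw [key _ _ _ h1, ad_antisymm, map_neg, key _ _ _ h2, ← map_neg, ← ad_antisymm]

/-! ### The Liouville measure of a coadjoint orbit of dimension `2k` -/

/-- The value of the `k`-th exterior power of a 2-form `om` on `2k` vectors
`e (0,0), e (0,1), e (1,0), e (1,1), …`. -/
def wedgePow {E : Type*} (k : ℕ) (om : E → E → ℝ) (e : Fin k × Fin 2 → E) : ℝ :=
  ((2 : ℝ) ^ k)⁻¹ * ∑ σ : Equiv.Perm (Fin k × Fin 2),
    ((Equiv.Perm.sign σ : ℤ) : ℝ) * ∏ i : Fin k, om (e (σ (i, 0))) (e (σ (i, 1)))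

/-- Local parametrizations of a `2k`-dimensional submanifold `S` of a normed space: smooth
immersions of an open set `U ⊆ ℝ^{2k}` that are homeomorphisms onto an open subset of `S`. -/
structure IsLocalParam {E : Type*} [NormedAddCommGroup E] [NormedSpace ℝ E] {k : ℕ}
    (S : Set E) (U : Set (Fin k × Fin 2 → ℝ)) (φ : (Fin k × Fin 2 → ℝ) → E) : Prop where
  isOpen : IsOpen U
  contDiffOn : ContDiffOn ℝ ∞ φ U
  immersion : ∀ x ∈ U, Function.Injective (fderiv ℝ φ x)
  mapsTo : Set.MapsTo φ U S
  isOpenEmbedding : Topology.IsOpenEmbedding (mapsTo.restrict φ U S)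

/-- The measure `|ω^k| / k!` in the local parametrization `φ` on `U`, where `ω` is the symplectic
form of the orbit: the image under `φ` of the measure on `U` whose density with respect to Lebesgue
measure is `|(φ^* ω)^k (∂₁, …, ∂₂ₖ)| / k!`. -/
def chartLiouville (B : LinearMap.BilinForm ℝ V) {k : ℕ} (U : Set (Fin k × Fin 2 → ℝ))
    (φ : (Fin k × Fin 2 → ℝ) → spDual B) : MeasureTheory.Measure (spDual B) :=
  MeasureTheory.Measure.map φ
    ((MeasureTheory.volume.restrict U).withDensity fun x =>
      ENNReal.ofReal
        (|wedgePow k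
            (fun a b : Fin k × Fin 2 → ℝ => kksForm (φ x) (fderiv ℝ φ x a) (fderiv ℝ φ x b))
            (fun p => Pi.single p (1 : ℝ))| / (Nat.factorial k : ℝ)))

/-- The Liouville measure `|ω^k| / k!` of a coadjoint orbit `O` of dimension `2k`, as a measure on
`sp(V)^*`: the measures of the local parametrizations of `O`, glued together (their supremum is the
measure on `O` that restricts to each of them). -/
def orbitLiouville (B : LinearMap.BilinForm ℝ V) (k : ℕ) (O : Set (spDual B)) :
    MeasureTheory.Measure (spDual B) :=
  sSup {ν | ∃ (U : Set (Fin k × Fin 2 → ℝ)) (φ : (Fin k × Fin 2 → ℝ) → spDual B),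
    IsLocalParam O U φ ∧ ν = chartLiouville B U φ}

/-- The Fourier transform `(2π)^{-k} ∫_O exp (i (f(X) + ω))` of a coadjoint orbit `O` of dimension
`2k`, as a generalized function of `X`, evaluated on the smooth compactly supported distribution
`ψ(X) dX` (with `dX` the measure `lam`). The integral over `O` is that of the component of maximal
degree `exp (i f(X)) (i ω)^k / k!`, for the orientation given by `ω^k`, so that it is `i^k` times an
integral for the Liouville measure. -/
def fourierOrbit (ι : ℂ) (B : LinearMap.BilinForm ℝ V) (k : ℕ) (O : Set (spDual B))
    (lam : MeasureTheory.Measure (sp B)) (ψ : sp B → ℂ) : ℂ :=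
  (((2 * Real.pi) ^ k)⁻¹ : ℝ) * (ι ^ k *
    ∫ f, (∫ X, ψ X * Complex.exp (ι * ((f X : ℝ) : ℂ)) ∂lam) ∂(orbitLiouville B k O))

/-! ### The moment map and the superPfaffian of a purely even symplectic space -/

/-- Half of the dimension of `V`. -/
def halfDim (V : Type*) [AddCommGroup V] [Module ℝ V] : ℕ := Module.finrank ℝ V / 2

/-- A symplectic basis `(e₁, f₁, …, eₖ, fₖ)`: `B eᵢ fⱼ = δᵢⱼ`, `B eᵢ eⱼ = B fᵢ fⱼ = 0`. -/
def IsSymplecticBasis {k : ℕ} (B : LinearMap.BilinForm ℝ V)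
    (b : Module.Basis (Fin k × Fin 2) ℝ V) : Prop :=
  ∀ i j : Fin k, B (b (i, 0)) (b (j, 1)) = (if i = j then 1 else 0) ∧
    B (b (i, 0)) (b (j, 0)) = 0 ∧ B (b (i, 1)) (b (j, 1)) = 0

section Moment

variable [FiniteDimensional ℝ V]

/-- The moment map `V → sp(V)^*`, `v ↦ (X ↦ -1/2 B(v, X v))`. -/
def moment (B : LinearMap.BilinForm ℝ V) (v : V) : spDual B :=
  (-(1 / 2) : ℝ) • ((LinearMap.toContinuousLinearMap (B v)).comp
    ((ContinuousLinearMap.apply ℝ V v).comp (sp B).subtypeL))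

theorem moment_apply (B : LinearMap.BilinForm ℝ V) (v : V) (X : sp B) :
    moment B v X = -(1 / 2) * B v ((X : V →L[ℝ] V) v) := rfl

/-- The set `Ω`: the image of the moment map with the origin removed. -/
def momentOrbit (B : LinearMap.BilinForm ℝ V) : Set (spDual B) :=
  Set.range (moment B) \ {0}

end Moment

section Pfaffian

variable [FiniteDimensional ℝ V] [MeasurableSpace V] [BorelSpace V]

/-- The Liouville integral `(2π)^{-k} |dx¹ … dx²ᵏ|` in the coordinates of the symplectic
basis `b`. -/
def liouville {k : ℕ} (b : Module.Basis (Fin k × Fin 2) ℝ V) : MeasureTheory.Measure V :=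
  ENNReal.ofReal (((2 * Real.pi) ^ k)⁻¹) • b.addHaar

/-- The superPfaffian `i^{m/2} ∫_V exp (-(i/2) B(v, X v)) dv` of the symplectic space `V` of
dimension `m = 2k`, as a generalized function of `X ∈ sp(V)`, evaluated on the smooth compactly
supported distribution `ψ(X) dX`: the integral over `X` is evaluated first. -/
def superPfaffian (ι : ℂ) (B : LinearMap.BilinForm ℝ V) {k : ℕ}
    (b : Module.Basis (Fin k × Fin 2) ℝ V)
    (lam : MeasureTheory.Measure (sp B)) (ψ : sp B → ℂ) : ℂ :=
  ι ^ k * ∫ v, (∫ X : sp B, ψ X *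
    Complex.exp (-(ι / 2) * ((B v ((X : V →L[ℝ] V) v) : ℝ) : ℂ)) ∂lam) ∂(liouville b)

end Pfaffian

end SpOrbit

end

noncomputable section

namespace SpOrbit

/-! ### Symmetric squares in the symplectic Lie algebra -/

section Algebra

variable {V : Type*} [NormedAddCommGroup V] [NormedSpace ℝ V] {B : LinearMap.BilinForm ℝ V}

/-! The map `moment` is quadratic, and on the square `symSq u w` it takes the value `B u v * B w v`
(`moment_symSq`). Nondegeneracy then gives the fibres `{v, -v}`. Since `moment` is equivariant and
transvections make `Sp(V)` transitive on nonzero vectors, `Ω` is one coadjoint orbit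
(`coadjointOrbit_moment`). Degree-two homogeneity gives `c ‖v‖² ≤ ‖moment v‖`, so `moment` is proper
and its range closed. The closure of `Ω` thus adds at most the origin, which is minimality. The free
action of `±1` makes `moment` a double cover. Infinitesimal equivariance (`coad_moment`) identifies
the pulled-back orbit form with `B`.

The density `|B^k| / k!` is `1` on a symplectic basis, so on each sheet the Liouville measure of `Ω`
is Lebesgue measure in symplectic coordinates. As there are two sheets, it is half of the image
measure (`orbitLiouville_eq`). The exponent `-(i/2) B(v, X v)` is `i` times `moment v X`, so both
generalized functions integrate the same function `dualFourier`, once over `V` and once over `Ω`.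
The half accounts for the factor `2` in the theorem.

Convergence and continuity in `ψ` come from the rapid decay of the Fourier transform of a test
function, transported to `V` by the quadratic lower bound (`exists_distribution`). -/

theorem apply_swap (hB : B.IsAlt) (v w : V) : B v w = -B w v :=
  (LinearMap.IsAlt.neg hB w v).symm

theorem exists_apply_ne_zero (hnd : B.Nondegenerate) {v : V} (hv : v ≠ 0) : ∃ u, B u v ≠ 0 := by
  by_contra! h
  exact hv (hnd.2 v h)

theorem exists_apply_eq_one (hnd : B.Nondegenerate) {v : V} (hv : v ≠ 0) : ∃ u, B u v = 1 := by
  obtain ⟨u, hu⟩ := exists_apply_ne_zero hnd hv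
  exact ⟨(B u v)⁻¹ • u, by simp [hu]⟩

/-- A nondegenerate pairing separates two nonzero vectors from zero simultaneously. -/
theorem exists_apply_ne_zero_and (hnd : B.Nondegenerate) {v w : V} (hv : v ≠ 0) (hw : w ≠ 0) :
    ∃ u, B u v ≠ 0 ∧ B u w ≠ 0 := by
  obtain ⟨a, ha⟩ := exists_apply_ne_zero hnd hv
  obtain ⟨b, hb⟩ := exists_apply_ne_zero hnd hw
  by_cases h1 : B a w = 0
  · by_cases h2 : B b v = 0
    · exact ⟨a + b, by simp [h2, ha], by simp [h1, hb]⟩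
    · exact ⟨b, h2, hb⟩
  · exact ⟨a, ha, h1⟩

theorem Ad_mul (g h : Sp B) (X : sp B) : Ad (g * h) X = Ad g (Ad h X) := rfl

theorem Ad_one (X : sp B) : Ad (1 : Sp B) X = X := rfl

theorem Ad_Ad_inv (g : Sp B) (X : sp B) : Ad g (Ad g⁻¹ X) = X := by
  rw [← Ad_mul, mul_inv_cancel, Ad_one]

theorem mem_coadjointOrbit_self (f : spDual B) : f ∈ coadjointOrbit f := ⟨1, fun _ => rfl⟩

theorem coadjointOrbit_zero : coadjointOrbit (0 : spDual B) = {0} := by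
  ext f
  refine ⟨fun ⟨g, hg⟩ => ?_, fun h => ?_⟩
  · ext X
    rw [← Ad_Ad_inv g X, hg]
    rfl
  · rw [Set.mem_singleton_iff.1 h]
    exact mem_coadjointOrbit_self 0

variable [FiniteDimensional ℝ V]

/-- The element `x ↦ B(u, x) w + B(w, x) u` of `sp(V)`. -/
def symSq (hB : B.IsAlt) (u w : V) : sp B :=
  ⟨LinearMap.toContinuousLinearMap ((B u).smulRight w + (B w).smulRight u), by
    intro x y
    simp [apply_swap hB x u, apply_swap hB x w]
    ring⟩

@[simp]
theorem symSq_apply (hB : B.IsAlt) (u w x : V) :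
    (symSq hB u w : V →L[ℝ] V) x = B u x • w + B w x • u := rfl

@[simp]
theorem moment_symSq (hB : B.IsAlt) (u w v : V) :
    moment B v (symSq hB u w) = B u v * B w v := by
  simp [moment_apply, apply_swap hB v u, apply_swap hB v w]
  ring

@[simp]
theorem moment_zero : moment B (0 : V) = 0 := by
  ext X
  simp [moment_apply]

theorem moment_neg (v : V) : moment B (-v) = moment B v := by
  ext X
  simp [moment_apply]

theorem moment_smul (c : ℝ) (v : V) : moment B (c • v) = c ^ 2 • moment B v := by
  ext X
  simp [moment_apply]
  ring

theorem moment_eq_zero_iff (hB : B.IsAlt) (hnd : B.Nondegenerate) {v : V} :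
    moment B v = 0 ↔ v = 0 := by
  refine ⟨fun h => ?_, fun h => by rw [h, moment_zero]⟩
  by_contra hv
  obtain ⟨u, hu⟩ := exists_apply_ne_zero hnd hv
  have := moment_symSq hB u u v
  rw [h] at this
  exact mul_ne_zero hu hu this.symm

/-- On `symSq u u` the difference of the two functionals is `B(u, v)² - B(u, w)² = B(u, v - w) B(u,
v + w)`. If neither factor vector vanished, a common `u` would make the product nonzero. -/
theorem moment_eq_moment_iff (hB : B.IsAlt) (hnd : B.Nondegenerate) {v w : V} :
    moment B v = moment B w ↔ v = w ∨ v = -w := by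
  refine ⟨fun h => ?_, ?_⟩
  · by_contra! hne
    obtain ⟨u, h1, h2⟩ := exists_apply_ne_zero_and hnd (sub_ne_zero.2 hne.1)
      (show v + w ≠ 0 from fun h0 => hne.2 (eq_neg_of_add_eq_zero_left h0))
    apply mul_ne_zero h1 h2
    have h3 := DFunLike.congr_fun h (symSq hB u u)
    simp only [moment_symSq] at h3
    simp only [map_sub, map_add]
    linear_combination h3
  · rintro (rfl | rfl)
    · rfl
    · exact moment_neg w

theorem moment_mem_momentOrbit (hB : B.IsAlt) (hnd : B.Nondegenerate) {v : V} (hv : v ≠ 0) :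
    moment B v ∈ momentOrbit B :=
  ⟨⟨v, rfl⟩, fun h => hv ((moment_eq_zero_iff hB hnd).1 h)⟩

theorem exists_moment_eq {f : spDual B} (hf : f ∈ momentOrbit B) :
    ∃ v ≠ 0, moment B v = f := by
  obtain ⟨⟨v, rfl⟩, h⟩ := hf
  exact ⟨v, fun h0 => h (by rw [h0, moment_zero]; rfl), rfl⟩

theorem moment_preimage_momentOrbit (hB : B.IsAlt) (hnd : B.Nondegenerate) :
    moment B ⁻¹' momentOrbit B = {0}ᶜ := by
  ext v
  refine ⟨fun h h0 => h.2 ?_, moment_mem_momentOrbit hB hnd⟩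
  rw [Set.mem_singleton_iff.1 h0, moment_zero]
  rfl

theorem moment_fiber_ncard (hB : B.IsAlt) (hnd : B.Nondegenerate) {f : spDual B}
    (hf : f ∈ momentOrbit B) : (moment B ⁻¹' {f}).ncard = 2 := by
  obtain ⟨v, hv, rfl⟩ := exists_moment_eq hf
  have : moment B ⁻¹' {moment B v} = {v, -v} := by
    ext w
    simp [moment_eq_moment_iff hB hnd]
  rw [this, Set.ncard_pair]
  intro h
  have h2 : (2 : ℝ) • v = 0 := by
    rw [two_smul]
    nth_rewrite 2 [h]
    exact add_neg_cancel v
  exact hv ((smul_eq_zero.1 h2).resolve_left two_ne_zero)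

/-! ### The infinitesimal action and the pull back of the symplectic form -/

/-- `sp(V)` acts transitively on nonzero vectors, infinitesimally. -/
theorem exists_sp_apply_eq (hB : B.IsAlt) (hnd : B.Nondegenerate) {v : V} (hv : v ≠ 0) (a : V) :
    ∃ X : sp B, (X : V →L[ℝ] V) v = a := by
  obtain ⟨u, hu⟩ := exists_apply_eq_one hnd hv
  -- Here `symSq u a` sends `v` to `a + B(a, v) u` and `symSq u u` sends `v` to `2 u`, which fixes
  -- the coefficient.
  refine ⟨symSq hB u a - (B a v / 2) • symSq hB u u, ?_⟩
  simp only [Submodule.coe_sub, Submodule.coe_smul, sub_apply, smul_apply, symSq_apply, hu]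
  module

/-- The differential of the moment map at `v`. -/
def momentDeriv (B : LinearMap.BilinForm ℝ V) (v : V) : V →L[ℝ] spDual B :=
  LinearMap.toContinuousLinearMap
    { toFun := fun a => (-(1 / 2) : ℝ) •
        ((LinearMap.toContinuousLinearMap (B a)).comp
            ((ContinuousLinearMap.apply ℝ V v).comp (sp B).subtypeL) +
          (LinearMap.toContinuousLinearMap (B v)).comp
            ((ContinuousLinearMap.apply ℝ V a).comp (sp B).subtypeL))
      map_add' := fun a b => by ext X; simp; ring
      map_smul' := fun c a => by ext X; simp; ring }

theorem momentDeriv_apply (v a : V) (X : sp B) :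
    momentDeriv B v a X =
      -(1 / 2) * (B a ((X : V →L[ℝ] V) v) + B v ((X : V →L[ℝ] V) a)) := rfl

theorem moment_eq_half_momentDeriv (v : V) : moment B v = (1 / 2 : ℝ) • momentDeriv B v v := by
  ext X
  simp [moment_apply, momentDeriv_apply]
  ring

/-- The moment map as a bilinear map evaluated on the diagonal. -/
def momentDerivL (B : LinearMap.BilinForm ℝ V) : V →L[ℝ] V →L[ℝ] spDual B :=
  LinearMap.toContinuousLinearMap
    { toFun := momentDeriv B
      map_add' := fun a b => by ext v X; simp [momentDeriv_apply]; ring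
      map_smul' := fun c a => by ext v X; simp [momentDeriv_apply]; ring }

theorem momentDerivL_apply (v : V) : momentDerivL B v = momentDeriv B v := rfl

theorem contDiff_moment : ContDiff ℝ ∞ (moment B) := by
  have : moment B = fun v => (1 / 2 : ℝ) • momentDerivL B v v :=
    funext moment_eq_half_momentDeriv
  rw [this]
  fun_prop

theorem continuous_moment : Continuous (moment B) := contDiff_moment.continuous

theorem hasFDerivAt_moment (v : V) : HasFDerivAt (moment B) (momentDeriv B v) v := by
  have h : moment B = fun v => (1 / 2 : ℝ) • momentDerivL B v v :=
    funext moment_eq_half_momentDeriv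
  rw [h]
  refine (((momentDerivL B).hasFDerivAt.clm_apply (hasFDerivAt_id v)).const_smul
    (1 / 2 : ℝ)).congr_fderiv ?_
  ext a X
  simp [momentDerivL_apply, momentDeriv_apply]
  ring

/-- Infinitesimal equivariance. With transitivity it makes every value of `momentDeriv B v` tangent
to the orbit when `v ≠ 0`, so `kksForm` is evaluated there outside its default case. -/
theorem coad_moment (X : sp B) (v : V) :
    coad X (moment B v) = momentDeriv B v ((X : V →L[ℝ] V) v) := by
  ext Y
  have h1 := X.2 v ((Y : V →L[ℝ] V) v)
  simp only [coad, neg_apply, ContinuousLinearMap.comp_apply, moment_apply, ad_coe, sub_apply,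
    mul_apply_eq_comp, map_sub, momentDeriv_apply]
  linear_combination (1 / 2) * h1

theorem kksForm_momentDeriv (hB : B.IsAlt) (hnd : B.Nondegenerate) {v : V} (hv : v ≠ 0)
    (a b : V) : kksForm (moment B v) (momentDeriv B v a) (momentDeriv B v b) = B a b := by
  obtain ⟨X, rfl⟩ := exists_sp_apply_eq hB hnd hv a
  obtain ⟨Y, rfl⟩ := exists_sp_apply_eq hB hnd hv b
  rw [← coad_moment, ← coad_moment, kksForm_coad, moment_apply, ad_coe]
  have h1 := X.2 v ((Y : V →L[ℝ] V) v)
  have h2 := Y.2 v ((X : V →L[ℝ] V) v)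
  have h3 := apply_swap hB ((X : V →L[ℝ] V) v) ((Y : V →L[ℝ] V) v)
  simp only [sub_apply, mul_apply_eq_comp, map_sub]
  linear_combination (-1 / 2) * h1 + (1 / 2) * h2 - (1 / 2) * h3

/-! ### The coadjoint orbit -/

/-- The symplectic transvection `x ↦ x + c B(u, x) u`. -/
def transvection (hB : B.IsAlt) (c : ℝ) (u : V) : Sp B :=
  ⟨LinearEquiv.toContinuousLinearEquiv
    { toFun := fun x => x + (c * B u x) • u
      invFun := fun x => x - (c * B u x) • u
      map_add' := fun x y => by simp only [map_add]; module
      map_smul' := fun r x => by simp only [map_smul, smul_eq_mul, RingHom.id_apply]; module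
      left_inv := fun x => by simp [hB u]
      right_inv := fun x => by simp [hB u] }, by
    intro x y
    change B (x + (c * B u x) • u) (y + (c * B u y) • u) = B x y
    simp [hB u, apply_swap hB x u]
    ring⟩

theorem transvection_apply (hB : B.IsAlt) (c : ℝ) (u x : V) :
    (transvection hB c u : V ≃L[ℝ] V) x = x + (c * B u x) • u := rfl

theorem exists_Sp_apply_eq_of_ne (hB : B.IsAlt) {v w : V} (h : B v w ≠ 0) :
    ∃ g : Sp B, (g : V ≃L[ℝ] V) v = w := by
  -- The coefficient is chosen so that `c B(w - v, v) = 1`, hence `v` moves by exactly `w - v`.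
  refine ⟨transvection hB (-(B v w)⁻¹) (w - v), ?_⟩
  have h1 : B (w - v) v = -B v w := by simp [hB v, apply_swap hB w v]
  rw [transvection_apply, h1, neg_mul_neg, inv_mul_cancel₀ h]
  module

/-- The symplectic group acts transitively on nonzero vectors. -/
theorem exists_Sp_apply_eq (hB : B.IsAlt) (hnd : B.Nondegenerate) {v w : V} (hv : v ≠ 0)
    (hw : w ≠ 0) : ∃ g : Sp B, (g : V ≃L[ℝ] V) v = w := by
  -- When `B v w = 0` a single transvection may not suffice; the route passes through a vector `u`
  -- orthogonal to neither.
  obtain ⟨u, hu1, hu2⟩ := exists_apply_ne_zero_and hnd hv hw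
  obtain ⟨g, hg⟩ := exists_Sp_apply_eq_of_ne hB
    (show B v u ≠ 0 by rw [apply_swap hB]; exact neg_ne_zero.2 hu1)
  obtain ⟨h, hh⟩ := exists_Sp_apply_eq_of_ne hB hu2
  refine ⟨h * g, ?_⟩
  change (h : V ≃L[ℝ] V) ((g : V ≃L[ℝ] V) v) = w
  rw [hg, hh]

theorem moment_apply_Ad (g : Sp B) (v : V) (X : sp B) :
    moment B ((g : V ≃L[ℝ] V) v) (Ad g X) = moment B v X := by
  rw [moment_apply, moment_apply]
  change -(1 / 2) * B _ ((g : V ≃L[ℝ] V) ((X : V →L[ℝ] V) ((g : V ≃L[ℝ] V).symm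
    ((g : V ≃L[ℝ] V) v)))) = _
  rw [ContinuousLinearEquiv.symm_apply_apply, g.2]

theorem coadjointOrbit_moment (hB : B.IsAlt) (hnd : B.Nondegenerate) {v : V} (hv : v ≠ 0) :
    coadjointOrbit (moment B v) = momentOrbit B := by
  ext f
  constructor
  · rintro ⟨g, hg⟩
    have : f = moment B ((g : V ≃L[ℝ] V) v) := by
      ext X
      rw [← Ad_Ad_inv g X, hg, moment_apply_Ad]
    rw [this]
    exact moment_mem_momentOrbit hB hnd (by simpa using hv)
  · intro hf
    obtain ⟨w, hw, rfl⟩ := exists_moment_eq hf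
    obtain ⟨g, rfl⟩ := exists_Sp_apply_eq hB hnd hv hw
    exact ⟨g, moment_apply_Ad g v⟩

theorem isNilpotentFunctional_moment (hB : B.IsAlt) (v : V) :
    IsNilpotentFunctional (moment B v) := by
  -- This element is the rank-one map `x ↦ -(1/2) B(v, x) v`: its square vanishes because `B v v =
  -- 0`, and its product with `Y` has trace `-(1/2) B(v, Y v)`.
  refine ⟨(-(1 / 4) : ℝ) • symSq hB v v, ⟨2, ?_⟩, fun Y => ?_⟩
  · ext x
    simp [pow_two, hB v]
  · have : (((((-(1 / 4) : ℝ) • symSq hB v v : sp B) : V →L[ℝ] V) * (Y : V →L[ℝ] V) :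
        V →L[ℝ] V) : V →ₗ[ℝ] V) =
        (-(1 / 2) : ℝ) • ((B v).comp ((Y : V →L[ℝ] V) : V →ₗ[ℝ] V)).smulRight v := by
      ext x
      simp
      module
    rw [this, map_smul, LinearMap.trace_smulRight, moment_apply]
    rfl

end Algebra

section Section

variable {V : Type*} [NormedAddCommGroup V] [NormedSpace ℝ V] [FiniteDimensional ℝ V]
  {B : LinearMap.BilinForm ℝ V}

/-! ### The moment map is proper -/

/-- By homogeneity of degree two, `c` can be the minimum of `‖moment‖` on the unit sphere, which is
positive because `moment` vanishes only at the origin. -/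
theorem exists_mul_sq_le_norm_moment (hB : B.IsAlt) (hnd : B.Nondegenerate) :
    ∃ c > 0, ∀ v : V, c * ‖v‖ ^ 2 ≤ ‖moment B v‖ := by
  rcases subsingleton_or_nontrivial V with hV | hV
  · exact ⟨1, one_pos, fun v => by simp [Subsingleton.elim v 0]⟩
  have hne : (Metric.sphere (0 : V) 1).Nonempty := NormedSpace.sphere_nonempty.2 zero_le_one
  obtain ⟨x, hx, hmin⟩ := (isCompact_sphere (0 : V) 1).exists_isMinOn hne
    (continuous_moment (B := B)).norm.continuousOn
  have hx1 : ‖x‖ = 1 := by simpa using hx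
  have hx0 : x ≠ 0 := fun h => by simp [h] at hx1
  refine ⟨‖moment B x‖, norm_pos_iff.2 fun h => hx0 ((moment_eq_zero_iff hB hnd).1 h),
    fun v => ?_⟩
  by_cases hv : v = 0
  · simp [hv]
  have hv' : ‖v‖ ≠ 0 := norm_ne_zero_iff.2 hv
  have h1 : ‖moment B x‖ ≤ ‖moment B (‖v‖⁻¹ • v)‖ :=
    hmin (by simp [norm_smul, hv'])
  rw [moment_smul, norm_smul, norm_pow, norm_inv, norm_norm] at h1
  calc ‖moment B x‖ * ‖v‖ ^ 2 ≤ (‖v‖⁻¹ ^ 2 * ‖moment B v‖) * ‖v‖ ^ 2 := by gcongr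
    _ = ‖moment B v‖ := by field_simp

theorem isClosedMap_moment (hB : B.IsAlt) (hnd : B.Nondegenerate) : IsClosedMap (moment B) := by
  obtain ⟨c, hc, h⟩ := exists_mul_sq_le_norm_moment hB hnd
  have : ProperSpace (spDual B) := FiniteDimensional.proper ℝ _
  have : ProperSpace V := FiniteDimensional.proper ℝ _
  refine (isProperMap_iff_tendsto_cocompact.2 ⟨continuous_moment, ?_⟩).isClosedMap
  rw [← Metric.cobounded_eq_cocompact, ← Metric.cobounded_eq_cocompact,
    ← tendsto_norm_atTop_iff_cobounded]
  refine Filter.tendsto_atTop_mono h ?_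
  exact ((Filter.tendsto_pow_atTop two_ne_zero).comp
    tendsto_norm_cobounded_atTop).const_mul_atTop hc

theorem isMinimalNilpotentOrbit_momentOrbit [Nontrivial V] (hB : B.IsAlt)
    (hnd : B.Nondegenerate) : IsMinimalNilpotentOrbit (momentOrbit B) := by
  obtain ⟨v, hv⟩ := exists_ne (0 : V)
  refine ⟨⟨moment B v, isNilpotentFunctional_moment hB v,
    (coadjointOrbit_moment hB hnd hv).symm⟩, fun h => ?_, ?_⟩
  · have : (0 : spDual B) ∈ momentOrbit B := by rw [h]; rfl
    exact this.2 rfl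
  · rintro _ ⟨f, -, rfl⟩ h0 hcl
    -- The closed range of `moment` contains the closure, so an orbit inside the closure passes
    -- through some `moment w`: it is `{0}` if `w = 0` and `Ω` otherwise.
    have h1 : closure (momentOrbit B) ⊆ Set.range (moment B) :=
      closure_minimal Set.sdiff_subset (isClosedMap_moment hB hnd).isClosed_range
    obtain ⟨w, rfl⟩ := h1 (hcl (mem_coadjointOrbit_self f))
    refine coadjointOrbit_moment hB hnd fun hw => h0 ?_
    rw [hw, moment_zero, coadjointOrbit_zero]

/-! ### The moment map is a double cover -/

/-- The restricted map is the quotient by the sign group `ℤˣ`: it is a quotient map because it is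
closed, and an open half space `B u > 0` is disjoint from its negative. -/
theorem isCoveringMap_moment (hB : B.IsAlt) (hnd : B.Nondegenerate) :
    IsCoveringMap ((momentOrbit B).restrictPreimage (moment B)) := by
  have hmem (g : ℤˣ) (v : V) (hv : v ∈ moment B ⁻¹' momentOrbit B) :
      (g : ℤ) • v ∈ moment B ⁻¹' momentOrbit B := by
    rcases Int.units_eq_one_or g with rfl | rfl
    · simpa using hv
    · simpa [moment_neg] using hv
  let _ : MulAction ℤˣ (moment B ⁻¹' momentOrbit B) :=
    { smul := fun g v => ⟨(g : ℤ) • (v : V), hmem g v v.2⟩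
      one_smul := fun v => Subtype.ext (by change ((1 : ℤˣ) : ℤ) • (v : V) = v; simp)
      mul_smul := fun g h v => Subtype.ext (by
        change ((g * h : ℤˣ) : ℤ) • (v : V) = (g : ℤ) • (h : ℤ) • (v : V)
        rw [Units.val_mul, mul_smul]) }
  have hcoe (g : ℤˣ) (v : moment B ⁻¹' momentOrbit B) : ((g • v : _) : V) = (g : ℤ) • (v : V) :=
    rfl
  have hcont : Continuous ((momentOrbit B).restrictPreimage (moment B)) :=
    continuous_moment.restrictPreimage
  have hsurj : Function.Surjective ((momentOrbit B).restrictPreimage (moment B)) := by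
    rintro ⟨f, hf⟩
    obtain ⟨v, hv, rfl⟩ := exists_moment_eq hf
    exact ⟨⟨v, hf⟩, rfl⟩
  have hq : IsQuotientCoveringMap ((momentOrbit B).restrictPreimage (moment B)) ℤˣ :=
    { toIsQuotientMap :=
        ((isClosedMap_moment hB hnd).restrictPreimage _).isQuotientMap hcont hsurj
      toContinuousConstSMul := ⟨fun g =>
        (continuous_subtype_val.const_smul (g : ℤ)).subtype_mk _⟩
      apply_eq_iff_mem_orbit := fun {v w} => by
        rw [Subtype.ext_iff, Set.restrictPreimage_coe, Set.restrictPreimage_coe,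
          moment_eq_moment_iff hB hnd, MulAction.mem_orbit_iff]
        constructor
        · rintro (h | h)
          · exact ⟨1, Subtype.ext (by simp [h])⟩
          · exact ⟨-1, Subtype.ext (by simp [hcoe, h])⟩
        · rintro ⟨g, rfl⟩
          rcases Int.units_eq_one_or g with rfl | rfl <;> simp [hcoe]
      disjoint := fun v => by
        have hv : (v : V) ≠ 0 := by
          exact (moment_preimage_momentOrbit hB hnd).subset v.2
        obtain ⟨u, hu⟩ := exists_apply_eq_one hnd hv
        refine ⟨{w | 0 < B u w}, ?_, fun g => ?_⟩
        · refine (isOpen_lt continuous_const ?_).mem_nhds ?_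
          · exact (LinearMap.continuous_of_finiteDimensional (B u)).comp continuous_subtype_val
          · simp [hu]
        · rintro ⟨_, ⟨w, hw, rfl⟩, hw'⟩
          rcases Int.units_eq_one_or g with rfl | rfl
          · rfl
          · have h1 : 0 < B u w := hw
            have h2 : 0 < B u (((-1 : ℤˣ) • w : _) : V) := hw'
            simp [hcoe] at h2
            linarith }
  exact hq.isCoveringMap

/-! ### Local sections of the moment map -/

/-- The open subset of `sp(V)^*` on which the square `x ↦ B(u, x) u` is positive. -/
def posSet (hB : B.IsAlt) (u : V) : Set (spDual B) := {f | 0 < f (symSq hB u u)}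

theorem isOpen_posSet (hB : B.IsAlt) (u : V) : IsOpen (posSet hB u) :=
  isOpen_lt continuous_const (ContinuousLinearMap.apply ℝ ℝ (symSq hB u u)).continuous

/-- The element `symSq u w` depends linearly on `w`. -/
def symSqL (hB : B.IsAlt) (u : V) : V →ₗ[ℝ] sp B where
  toFun := symSq hB u
  map_add' w w' := by ext x; simp; module
  map_smul' c w := by ext x; simp; module

omit [FiniteDimensional ℝ V] in
theorem nondegenerate_flip (hnd : B.Nondegenerate) : B.flip.Nondegenerate := ⟨hnd.2, hnd.1⟩

/-- The linear map from `sp(V)^*` to `V` that sends `moment v` to `B(u, v) v`. -/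
def dualVec (hB : B.IsAlt) (hnd : B.Nondegenerate) (u : V) : spDual B →L[ℝ] V :=
  LinearMap.toContinuousLinearMap
    ((LinearMap.BilinForm.toDual B.flip (nondegenerate_flip hnd)).symm.toLinearMap ∘ₗ
      ({ toFun := fun f => (f : sp B →ₗ[ℝ] ℝ) ∘ₗ symSqL hB u
         map_add' := fun _ _ => rfl
         map_smul' := fun _ _ => rfl } : spDual B →ₗ[ℝ] Module.Dual ℝ V))

theorem dualVec_moment (hB : B.IsAlt) (hnd : B.Nondegenerate) (u v : V) :
    dualVec hB hnd u (moment B v) = B u v • v := by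
  change (LinearMap.BilinForm.toDual B.flip (nondegenerate_flip hnd)).symm _ = _
  rw [LinearEquiv.symm_apply_eq]
  ext w
  rw [LinearMap.BilinForm.toDual_def]
  change moment B v (symSq hB u w) = B w (B u v • v)
  simp

/-- A section of the moment map over `posSet hB u`. -/
def momentSection (hB : B.IsAlt) (hnd : B.Nondegenerate) (u : V) (f : spDual B) : V :=
  (Real.sqrt (f (symSq hB u u)))⁻¹ • dualVec hB hnd u f

/-- The square root recovers `|B u v|`; the sign hypothesis selects the sheet on which it equals `B
u v`, the factor carried by `dualVec`. -/
theorem momentSection_moment (hB : B.IsAlt) (hnd : B.Nondegenerate) {u v : V} (h : 0 < B u v) :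
    momentSection hB hnd u (moment B v) = v := by
  rw [momentSection, dualVec_moment, moment_symSq, Real.sqrt_mul_self h.le, smul_smul,
    inv_mul_cancel₀ h.ne', one_smul]

theorem contDiffOn_momentSection (hB : B.IsAlt) (hnd : B.Nondegenerate) (u : V) :
    ContDiffOn ℝ ∞ (momentSection hB hnd u) (posSet hB u) := by
  have h1 : ContDiffOn ℝ ∞ (fun f : spDual B => f (symSq hB u u)) (posSet hB u) :=
    (ContinuousLinearMap.apply ℝ ℝ (symSq hB u u)).contDiff.contDiffOn
  refine ((h1.sqrt fun f hf => (ne_of_gt hf)).inv fun f hf => ?_).smul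
    (dualVec hB hnd u).contDiff.contDiffOn
  exact (Real.sqrt_pos.2 hf).ne'

theorem moment_mem_posSet (hB : B.IsAlt) {u v : V} :
    moment B v ∈ posSet hB u ↔ B u v ≠ 0 := by
  rw [posSet, Set.mem_ofPred_eq, moment_symSq, mul_self_pos]

theorem exists_pos_moment_eq (hB : B.IsAlt) {u : V} {f : spDual B}
    (hf : f ∈ momentOrbit B) (hu : f ∈ posSet hB u) : ∃ v, 0 < B u v ∧ moment B v = f := by
  obtain ⟨v, -, rfl⟩ := exists_moment_eq hf
  rw [moment_mem_posSet] at hu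
  rcases lt_or_gt_of_ne hu with h | h
  · exact ⟨-v, by simpa using h, moment_neg v⟩
  · exact ⟨v, h, rfl⟩

theorem moment_momentSection (hB : B.IsAlt) (hnd : B.Nondegenerate) {u : V} {f : spDual B}
    (hf : f ∈ momentOrbit B) (hu : f ∈ posSet hB u) :
    moment B (momentSection hB hnd u f) = f := by
  obtain ⟨v, hv, rfl⟩ := exists_pos_moment_eq hB hf hu
  rw [momentSection_moment hB hnd hv]

theorem apply_momentSection_pos (hB : B.IsAlt) (hnd : B.Nondegenerate) {u : V} {f : spDual B}
    (hf : f ∈ momentOrbit B) (hu : f ∈ posSet hB u) :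
    0 < B u (momentSection hB hnd u f) := by
  obtain ⟨v, hv, rfl⟩ := exists_pos_moment_eq hB hf hu
  rwa [momentSection_moment hB hnd hv]

/-- A kernel vector would lie in the radical of the pulled-back form, which is the nondegenerate
`B`. -/
theorem momentDeriv_injective (hB : B.IsAlt) (hnd : B.Nondegenerate) {v : V} (hv : v ≠ 0) :
    Function.Injective (momentDeriv B v) := by
  refine (injective_iff_map_eq_zero _).2 fun a ha => hnd.1 a fun b => ?_
  rw [← kksForm_momentDeriv hB hnd hv, ha, ← map_zero (momentDeriv B v),
    kksForm_momentDeriv hB hnd hv, map_zero, LinearMap.zero_apply]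

/-- The moment map parametrizes its image in linear coordinates, on each open half space. -/
theorem isLocalParam_moment (hB : B.IsAlt) (hnd : B.Nondegenerate) (u : V) {k : ℕ}
    (e : (Fin k × Fin 2 → ℝ) ≃L[ℝ] V) :
    IsLocalParam (momentOrbit B) {x | 0 < B u (e x)} (fun x => moment B (e x)) := by
  have hne (x : Fin k × Fin 2 → ℝ) (hx : 0 < B u (e x)) : e x ≠ 0 := fun h => by
    simp [h] at hx
  have hBu : Continuous (B u) := LinearMap.continuous_of_finiteDimensional _
  have hmaps : Set.MapsTo (fun x => moment B (e x)) {x | 0 < B u (e x)} (momentOrbit B) :=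
    fun x hx => moment_mem_momentOrbit hB hnd (hne x hx)
  refine
    { isOpen := isOpen_lt continuous_const (hBu.comp e.continuous)
      contDiffOn := (contDiff_moment.comp e.contDiff).contDiffOn
      immersion := fun x hx => ?_
      mapsTo := hmaps
      isOpenEmbedding := ?_ }
  · have : HasFDerivAt (fun x => moment B (e x))
        ((momentDeriv B (e x)).comp (e : (Fin k × Fin 2 → ℝ) →L[ℝ] V)) x :=
      (hasFDerivAt_moment (e x)).comp x e.hasFDerivAt
    rw [this.fderiv]
    exact (momentDeriv_injective hB hnd (hne x hx)).comp e.injective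
  · refine Topology.IsOpenEmbedding.of_continuous_injective_isOpenMap ?_ ?_ ?_
    · exact (continuous_moment.comp (e.continuous.comp continuous_subtype_val)).subtype_mk _
    · rintro ⟨x, hx⟩ ⟨y, hy⟩ h
      have h1 : moment B (e x) = moment B (e y) := congrArg Subtype.val h
      have h2 := congrArg (momentSection hB hnd u) h1
      rw [momentSection_moment hB hnd hx, momentSection_moment hB hnd hy] at h2
      exact Subtype.ext (e.injective h2)
    · intro W hW
      obtain ⟨W', hW', rfl⟩ := hW
      have hcont : ContinuousOn (fun f : momentOrbit B => e.symm (momentSection hB hnd u f))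
          {f | (f : spDual B) ∈ posSet hB u} :=
        e.symm.continuous.comp_continuousOn
          ((contDiffOn_momentSection hB hnd u).continuousOn.comp
            continuous_subtype_val.continuousOn fun _ h => h)
      have ho : IsOpen {f : momentOrbit B | (f : spDual B) ∈ posSet hB u} :=
        (isOpen_posSet hB u).preimage continuous_subtype_val
      -- The image of `W` is the preimage of `W'` under the continuous section, inside the open set
      -- where the section is defined.
      convert hcont.isOpen_inter_preimage ho hW' using 1
      ext f
      constructor
      · rintro ⟨⟨x, hx⟩, hxW, rfl⟩
        refine ⟨(moment_mem_posSet hB).2 (ne_of_gt hx), ?_⟩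
        change e.symm (momentSection hB hnd u (moment B (e x))) ∈ W'
        rw [momentSection_moment hB hnd hx, e.symm_apply_apply]
        exact hxW
      · rintro ⟨h1, h2⟩
        refine ⟨⟨e.symm (momentSection hB hnd u f), ?_⟩, h2, Subtype.ext ?_⟩
        · change 0 < B u (e _)
          rw [e.apply_symm_apply]
          exact apply_momentSection_pos hB hnd f.2 h1
        · change moment B (e _) = _
          rw [e.apply_symm_apply]
          exact moment_momentSection hB hnd f.2 h1

end Section

/-! ### Powers of a two-form -/

section Wedge

variable {E : Type*} [AddCommGroup E] [Module ℝ E] {k : ℕ}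

/-- The multilinear form `∏ i, om(e (i, 0), e (i, 1))`. -/
def pairProd (k : ℕ) (om : LinearMap.BilinForm ℝ E) :
    MultilinearMap ℝ (fun _ : Fin k × Fin 2 => E) ℝ :=
  MultilinearMap.mk' (fun e => ∏ i : Fin k, om (e (i, 0)) (e (i, 1)))
    (fun e j x y => by
      obtain ⟨j, c⟩ := j
      rw [← Finset.mul_prod_erase _ _ (Finset.mem_univ j),
        ← Finset.mul_prod_erase _ _ (Finset.mem_univ j),
        ← Finset.mul_prod_erase _ _ (Finset.mem_univ j)]
      have h (z : E) : ∏ i ∈ Finset.univ.erase j, om (Function.update e (j, c) z (i, 0))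
          (Function.update e (j, c) z (i, 1)) =
          ∏ i ∈ Finset.univ.erase j, om (e (i, 0)) (e (i, 1)) :=
        Finset.prod_congr rfl fun i hi => by
          have := Finset.ne_of_mem_erase hi
          simp [this]
      rw [h, h, h, ← add_mul]
      congr 1
      fin_cases c <;> simp)
    (fun e j r x => by
      obtain ⟨j, c⟩ := j
      rw [← Finset.mul_prod_erase _ _ (Finset.mem_univ j),
        ← Finset.mul_prod_erase _ _ (Finset.mem_univ j)]
      have h (z : E) : ∏ i ∈ Finset.univ.erase j, om (Function.update e (j, c) z (i, 0))
          (Function.update e (j, c) z (i, 1)) =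
          ∏ i ∈ Finset.univ.erase j, om (e (i, 0)) (e (i, 1)) :=
        Finset.prod_congr rfl fun i hi => by
          have := Finset.ne_of_mem_erase hi
          simp [this]
      rw [h, h, smul_eq_mul, ← mul_assoc]
      congr 1
      fin_cases c <;> simp)

/-- Brings in the one-dimensionality of top-degree alternating forms, hence the determinant. -/
theorem wedgePow_eq_alternatization (om : LinearMap.BilinForm ℝ E) (e : Fin k × Fin 2 → E) :
    wedgePow k (fun a b => om a b) e =
      ((2 : ℝ) ^ k)⁻¹ * MultilinearMap.alternatization (pairProd k om) e := by
  rw [wedgePow, MultilinearMap.alternatization_apply]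
  congr 1
  refine Finset.sum_congr rfl fun σ _ => ?_
  rw [Units.smul_def, zsmul_eq_mul]
  rfl

/-- The top power of a two-form scales by the determinant. -/
theorem wedgePow_comp (om : LinearMap.BilinForm ℝ E)
    (b : Module.Basis (Fin k × Fin 2) ℝ E) (D : (Fin k × Fin 2 → ℝ) →ₗ[ℝ] (Fin k × Fin 2 → ℝ)) :
    wedgePow k (fun x y => om (b.equivFun.symm (D x)) (b.equivFun.symm (D y)))
        (fun p => Pi.single p (1 : ℝ)) =
      LinearMap.det D * wedgePow k (fun x y => om x y) b := by
  have h1 : wedgePow k (fun x y => om (b.equivFun.symm (D x)) (b.equivFun.symm (D y)))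
        (fun p => Pi.single p (1 : ℝ)) =
      wedgePow k (fun x y => om x y) (fun p => b.equivFun.symm (D (Pi.single p 1))) := rfl
  rw [h1, wedgePow_eq_alternatization, wedgePow_eq_alternatization,
    AlternatingMap.eq_smul_basis_det (e := b) (MultilinearMap.alternatization (pairProd k om))]
  have h2 : (fun p => b.equivFun.symm (D (Pi.single p 1))) =
      (b.equivFun.symm.toLinearMap ∘ₗ D ∘ₗ b.equivFun.toLinearMap) ∘ b := by
    ext p
    simp [Finsupp.single_eq_pi_single]
  have h3 : LinearMap.det (b.equivFun.symm.toLinearMap ∘ₗ D ∘ₗ b.equivFun.toLinearMap) =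
      LinearMap.det D := LinearMap.det_conj D b.equivFun.symm
  rw [h2, AlternatingMap.smul_apply, AlternatingMap.smul_apply, Module.Basis.det_comp,
    Module.Basis.det_self, h3]
  simp only [smul_eq_mul]
  ring

variable {V : Type*} [NormedAddCommGroup V] [NormedSpace ℝ V] {B : LinearMap.BilinForm ℝ V}

/-- Within a pair the value is written as a difference of indices, matching the formula for the sign
in `sign_fin_two`. -/
theorem IsSymplecticBasis.apply_eq (hB : B.IsAlt) {b : Module.Basis (Fin k × Fin 2) ℝ V}
    (hb : IsSymplecticBasis B b) (p q : Fin k × Fin 2) :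
    B (b p) (b q) = if p.1 = q.1 then ((q.2 : ℕ) : ℝ) - ((p.2 : ℕ) : ℝ) else 0 := by
  obtain ⟨i, c⟩ := p
  obtain ⟨j, d⟩ := q
  fin_cases c <;> fin_cases d
  · simpa using (hb i j).2.1
  · simpa using (hb i j).1
  · have := (hb j i).1
    simp [apply_swap hB (b (i, 1)), this, eq_comm (a := i)]
    split_ifs <;> simp
  · simpa using (hb i j).2.2

/-- The permutation of `Fin k × Fin 2` that permutes the pairs by `τ` after permuting the
members of each pair by `ε`. -/
def pairPerm (p : Equiv.Perm (Fin k) × (Fin k → Equiv.Perm (Fin 2))) :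
    Equiv.Perm (Fin k × Fin 2) :=
  Equiv.prodCongrLeft (fun _ => p.1) * Equiv.prodCongrRight p.2

theorem pairPerm_apply (p : Equiv.Perm (Fin k) × (Fin k → Equiv.Perm (Fin 2))) (i : Fin k)
    (c : Fin 2) : pairPerm p (i, c) = (p.1 i, p.2 i c) := rfl

theorem pairPerm_injective : Function.Injective (pairPerm (k := k)) := by
  intro p q h
  have h1 (i : Fin k) (c : Fin 2) : (p.1 i, p.2 i c) = (q.1 i, q.2 i c) := by
    rw [← pairPerm_apply, h, pairPerm_apply]
  refine Prod.ext (Equiv.ext fun i => congrArg Prod.fst (h1 i 0))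
    (funext fun i => Equiv.ext fun c => congrArg Prod.snd (h1 i c))

/-- The permutation of the pairs acts once on each of the two members, so its sign enters squared.
-/
theorem sign_pairPerm (p : Equiv.Perm (Fin k) × (Fin k → Equiv.Perm (Fin 2))) :
    Equiv.Perm.sign (pairPerm p) = ∏ i, Equiv.Perm.sign (p.2 i) := by
  rw [pairPerm, Equiv.Perm.sign_mul, Equiv.Perm.sign_prodCongrLeft,
    Equiv.Perm.sign_prodCongrRight]
  simp

theorem sign_fin_two (ε : Equiv.Perm (Fin 2)) :
    ((Equiv.Perm.sign ε : ℤ) : ℝ) = ((ε 1 : ℕ) : ℝ) - ((ε 0 : ℕ) : ℝ) := by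
  have : ∀ ε : Equiv.Perm (Fin 2), (Equiv.Perm.sign ε : ℤ) = ((ε 1 : ℕ) : ℤ) - ((ε 0 : ℕ) : ℤ) := by
    decide
  rw [this]
  push_cast
  rfl

theorem exists_pairPerm_eq (σ : Equiv.Perm (Fin k × Fin 2))
    (h : ∀ i, (σ (i, 0)).1 = (σ (i, 1)).1) : ∃ p, pairPerm p = σ := by
  have hne (i : Fin k) : (σ (i, 0)).2 ≠ (σ (i, 1)).2 := fun h2 => by
    have := σ.injective (Prod.ext (h i) h2)
    simp at this
  have h1 (i : Fin k) (c : Fin 2) : (σ (i, c)).1 = (σ (i, 0)).1 := by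
    fin_cases c
    · rfl
    · exact (h i).symm
  have hτ : Function.Surjective fun i => (σ (i, 0)).1 := fun j => by
    obtain ⟨⟨i, c⟩, hi⟩ := σ.surjective (j, 0)
    exact ⟨i, by simp only; rw [← h1 i c, hi]⟩
  have hε (i : Fin k) : Function.Injective fun c => (σ (i, c)).2 := by
    intro c d hcd
    have := σ.injective (Prod.ext ((h1 i c).trans (h1 i d).symm) hcd)
    simpa using this
  refine ⟨(Equiv.ofBijective _ (Finite.surjective_iff_bijective.1 hτ),
    fun i => Equiv.ofBijective _ (Finite.injective_iff_bijective.1 (hε i))), ?_⟩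
  ext ⟨i, c⟩ : 1
  rw [pairPerm_apply]
  exact Prod.ext (h1 i c).symm rfl

/-- The Liouville volume of a symplectic basis. -/
theorem wedgePow_symplecticBasis (hB : B.IsAlt) {b : Module.Basis (Fin k × Fin 2) ℝ V}
    (hb : IsSymplecticBasis B b) :
    wedgePow k (fun x y => B x y) b = (Nat.factorial k : ℝ) := by
  have h : ∑ σ : Equiv.Perm (Fin k × Fin 2), ((Equiv.Perm.sign σ : ℤ) : ℝ) *
      ∏ i : Fin k, B (b (σ (i, 0))) (b (σ (i, 1))) =
      ∑ _p : Equiv.Perm (Fin k) × (Fin k → Equiv.Perm (Fin 2)), (1 : ℝ) := by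
    symm
    -- Only permutations preserving the pairs contribute. Each contributes `1`, its sign being the
    -- product of the pairings, and there are `k! 2^k` of them.
    refine Finset.sum_of_injOn pairPerm pairPerm_injective.injOn (fun _ _ => Finset.mem_univ _)
      (fun σ _ hσ => ?_) (fun p _ => ?_)
    · have : ∃ i, (σ (i, 0)).1 ≠ (σ (i, 1)).1 := by
        by_contra! h
        obtain ⟨p, hp⟩ := exists_pairPerm_eq σ h
        exact hσ ⟨p, by simp, hp⟩
      obtain ⟨i, hi⟩ := this
      rw [Finset.prod_eq_zero (Finset.mem_univ i), mul_zero]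
      rw [hb.apply_eq hB, if_neg hi]
    · rw [sign_pairPerm]
      push_cast
      rw [← Finset.prod_mul_distrib]
      symm
      refine Finset.prod_eq_one fun i _ => ?_
      rw [pairPerm_apply, pairPerm_apply, hb.apply_eq hB, if_pos rfl, sign_fin_two]
      generalize p.2 i = ε
      have h1 : ∀ ε : Equiv.Perm (Fin 2),
          (((ε 1 : ℕ) : ℤ) - ((ε 0 : ℕ) : ℤ)) * (((ε 1 : ℕ) : ℤ) - ((ε 0 : ℕ) : ℤ)) = 1 := by
        decide
      exact_mod_cast h1 ε
  rw [wedgePow, h]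
  simp [Fintype.card_perm]
  field_simp

/-! ### Existence of symplectic bases -/

/-- The relations of a symplectic basis, for a family of vectors. -/
def IsSymplecticFamily (B : LinearMap.BilinForm ℝ V) (b : Fin k × Fin 2 → V) : Prop :=
  ∀ i j : Fin k, B (b (i, 0)) (b (j, 1)) = (if i = j then 1 else 0) ∧
    B (b (i, 0)) (b (j, 0)) = 0 ∧ B (b (i, 1)) (b (j, 1)) = 0

theorem IsSymplecticFamily.linearIndependent {b : Fin k × Fin 2 → V}
    (hb : IsSymplecticFamily B b) : LinearIndependent ℝ b := by
  rw [Fintype.linearIndependent_iff]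
  rintro g hg ⟨i, c⟩
  rw [Fintype.sum_prod_type] at hg
  simp only [Fin.sum_univ_two] at hg
  fin_cases c
  · have := congrArg (fun x => B x (b (i, 1))) hg
    simpa [(hb _ _).1, (hb _ _).2.2] using this
  · have := congrArg (B (b (i, 0))) hg
    simpa [(hb _ _).1, (hb _ _).2.1] using this

/-- The component of `x` orthogonal to a symplectic family. -/
def orthComponent (B : LinearMap.BilinForm ℝ V) (b : Fin k × Fin 2 → V) (x : V) : V :=
  x - ∑ i, (B x (b (i, 1)) • b (i, 0) - B x (b (i, 0)) • b (i, 1))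

theorem IsSymplecticFamily.orthComponent_apply (hB : B.IsAlt) {b : Fin k × Fin 2 → V}
    (hb : IsSymplecticFamily B b) (x : V) (p : Fin k × Fin 2) :
    B (orthComponent B b x) (b p) = 0 := by
  obtain ⟨j, c⟩ := p
  have h10 (i j : Fin k) : B (b (i, 1)) (b (j, 0)) = -(if j = i then 1 else 0) := by
    rw [apply_swap hB, (hb j i).1]
  fin_cases c
  · simp [orthComponent, h10, (hb _ _).2.1]
  · simp [orthComponent, (hb _ _).1, (hb _ _).2.2]

/-- Enlarging a symplectic family by a symplectic pair orthogonal to it. -/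
theorem IsSymplecticFamily.snoc (hB : B.IsAlt) {b : Fin k × Fin 2 → V}
    (hb : IsSymplecticFamily B b) {v w : V} (hv : ∀ p, B v (b p) = 0) (hw : ∀ p, B w (b p) = 0)
    (hvw : B v w = 1) :
    IsSymplecticFamily (k := k + 1) B
      (fun p => Fin.snoc (α := fun _ => V) (fun i => b (i, p.2)) (![v, w] p.2) p.1) := by
  have hv' (p) : B (b p) v = 0 := by rw [apply_swap hB, hv, neg_zero]
  have hw' (p) : B (b p) w = 0 := by rw [apply_swap hB, hw, neg_zero]
  intro i j
  refine Fin.lastCases ?_ (fun i => ?_) i <;> refine Fin.lastCases ?_ (fun j => ?_) j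
  · simp [hvw, hB v, hB w]
  · simp [hv, hw, (Fin.castSucc_lt_last j).ne']
  · simp [hv', hw', (Fin.castSucc_lt_last i).ne]
  · simpa using hb i j

/-- A symplectic family is independent, so its size is bounded and some family cannot be enlarged.
If it did not span, the orthogonal component of a missed vector would start a further pair. -/
theorem exists_isSymplecticBasis [FiniteDimensional ℝ V] (hB : B.IsAlt) (hnd : B.Nondegenerate) :
    ∃ b : Module.Basis (Fin (halfDim V) × Fin 2) ℝ V, IsSymplecticBasis B b := by
  classical
  let P : ℕ → Prop := fun k => ∃ b : Fin k × Fin 2 → V, IsSymplecticFamily B b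
  have hle (k : ℕ) (hk : P k) : k ≤ halfDim V := by
    obtain ⟨b, hb⟩ := hk
    have := (hb.linearIndependent).fintype_card_le_finrank
    simp only [Fintype.card_prod, Fintype.card_fin] at this
    rw [halfDim]
    omega
  have h0 : P 0 := ⟨fun p => p.1.elim0, fun i => i.elim0⟩
  obtain ⟨k, hk, hmax⟩ : ∃ k, P k ∧ ¬ P (k + 1) := by
    by_contra! h
    have hall (k : ℕ) : P k := Nat.rec h0 h k
    exact absurd (hle _ (hall (halfDim V + 1))) (by omega)
  obtain ⟨b, hb⟩ := hk
  have hli := hb.linearIndependent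
  have hspan : ⊤ ≤ Submodule.span ℝ (Set.range b) := by
    intro x _
    by_contra hx
    have hv0 : orthComponent B b x ≠ 0 := fun h => by
      rw [orthComponent, sub_eq_zero] at h
      rw [h] at hx
      refine hx (Submodule.sum_mem _ fun i _ => Submodule.sub_mem _ ?_ ?_)
      · exact Submodule.smul_mem _ _ (Submodule.subset_span ⟨_, rfl⟩)
      · exact Submodule.smul_mem _ _ (Submodule.subset_span ⟨_, rfl⟩)
    set v := orthComponent B b x with hvdef
    have hv : ∀ p, B v (b p) = 0 := hb.orthComponent_apply hB x
    obtain ⟨u, hu⟩ := exists_apply_eq_one hnd hv0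
    -- Since `v` is orthogonal to the family, projecting `-u` does not change its pairing with `v`,
    -- which is `-B v u = B u v = 1`.
    refine hmax ⟨_, hb.snoc hB hv (hb.orthComponent_apply hB (-u)) ?_⟩
    rw [orthComponent, map_sub, map_sum]
    simp [hv, apply_swap hB v u, hu]
  have hk : k = halfDim V := by
    have := Module.finrank_eq_card_basis (Module.Basis.mk hli hspan)
    simp only [Fintype.card_prod, Fintype.card_fin] at this
    rw [halfDim, this]
    omega
  subst hk
  exact ⟨Module.Basis.mk hli hspan, fun i j => by simpa using hb i j⟩

end Wedge

open MeasureTheory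

/-! ### The Liouville measure of the orbit -/

section Liouville

variable {V : Type*} [NormedAddCommGroup V] [NormedSpace ℝ V] [FiniteDimensional ℝ V]
  {B : LinearMap.BilinForm ℝ V} {k : ℕ}

theorem measurableSet_momentOrbit (hB : B.IsAlt) (hnd : B.Nondegenerate) :
    MeasurableSet (momentOrbit B) :=
  (isClosedMap_moment hB hnd).isClosed_range.measurableSet.diff (measurableSet_singleton 0)

omit [FiniteDimensional ℝ V] in
theorem IsLocalParam.measurableSet_image {S : Set (spDual B)} {U : Set (Fin k × Fin 2 → ℝ)}
    {φ : (Fin k × Fin 2 → ℝ) → spDual B} (h : IsLocalParam S U φ) (hS : MeasurableSet S) :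
    MeasurableSet (φ '' U) := by
  have h1 : φ '' U = Subtype.val '' Set.range (h.mapsTo.restrict φ U S) := by
    rw [← Set.range_comp]
    ext f
    simp
  rw [h1]
  exact hS.subtype_image h.isOpenEmbedding.isOpen_range.measurableSet

theorem measurableSet_inter_preimage {E F : Type*} [TopologicalSpace E] [MeasurableSpace E]
    [BorelSpace E] [TopologicalSpace F] [MeasurableSpace F] [BorelSpace F] {φ : E → F}
    {U : Set E} (hU : MeasurableSet U) (hφ : ContinuousOn φ U) {A : Set F} (hA : MeasurableSet A) :
    MeasurableSet (U ∩ φ ⁻¹' A) := by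
  have h := (continuousOn_iff_continuous_domRestrict.1 hφ).measurable hA
  convert hU.subtype_image h using 1
  ext x
  simp [and_comm]

/-- Coordinates in a basis. -/
def coordEquiv (b : Module.Basis (Fin k × Fin 2) ℝ V) : (Fin k × Fin 2 → ℝ) ≃L[ℝ] V :=
  b.equivFun.symm.toContinuousLinearEquiv

omit [FiniteDimensional ℝ V] in
theorem coordEquiv_apply (b : Module.Basis (Fin k × Fin 2) ℝ V) (x : Fin k × Fin 2 → ℝ) :
    coordEquiv b x = b.equivFun.symm x := rfl

/-- Half of the image under the moment map of the Lebesgue measure in the coordinates of a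
basis. -/
def momentMeasure (B : LinearMap.BilinForm ℝ V) (b : Module.Basis (Fin k × Fin 2) ℝ V) :
    Measure (spDual B) :=
  (2 : ENNReal)⁻¹ • Measure.map (fun x => moment B (coordEquiv b x)) volume

theorem continuous_moment_coordEquiv (b : Module.Basis (Fin k × Fin 2) ℝ V) :
    Continuous fun x => moment B (coordEquiv b x) :=
  continuous_moment.comp (coordEquiv b).continuous

theorem momentMeasure_apply (b : Module.Basis (Fin k × Fin 2) ℝ V) {A : Set (spDual B)}
    (hA : MeasurableSet A) :
    momentMeasure B b A = (2 : ENNReal)⁻¹ * volume {x | moment B (coordEquiv b x) ∈ A} := by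
  rw [momentMeasure, Measure.smul_apply,
    Measure.map_apply (continuous_moment_coordEquiv b).measurable hA, smul_eq_mul]
  rfl

/-- On the open set where `B u v ≠ 0`, the moment map counts each sheet once. -/
theorem momentMeasure_apply_of_subset_posSet (hB : B.IsAlt)
    (b : Module.Basis (Fin k × Fin 2) ℝ V) (u : V) {A : Set (spDual B)} (hA : MeasurableSet A)
    (hu : A ⊆ posSet hB u) :
    momentMeasure B b A =
      volume {x | 0 < B u (coordEquiv b x) ∧ moment B (coordEquiv b x) ∈ A} := by
  set P := {x | 0 < B u (coordEquiv b x) ∧ moment B (coordEquiv b x) ∈ A} with hP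
  have hBu : Continuous (B u) := LinearMap.continuous_of_finiteDimensional _
  have hPm : MeasurableSet P :=
    (isOpen_lt continuous_const (hBu.comp (coordEquiv b).continuous)).measurableSet.inter
      ((continuous_moment_coordEquiv b).measurable hA)
  have h1 : {x | moment B (coordEquiv b x) ∈ A} = P ∪ -P := by
    ext x
    simp only [hP, Set.mem_union, Set.mem_neg, Set.mem_ofPred_eq, map_neg, moment_neg]
    refine ⟨fun h => ?_, fun h => h.elim And.right And.right⟩
    rcases lt_or_gt_of_ne ((moment_mem_posSet hB).1 (hu h)) with h2 | h2
    · exact Or.inr ⟨by linarith, h⟩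
    · exact Or.inl ⟨h2, h⟩
  have h2 : Disjoint P (-P) := by
    rw [Set.disjoint_left]
    rintro x ⟨h3, -⟩ ⟨h4, -⟩
    simp only [map_neg] at h4
    linarith
  rw [momentMeasure_apply b hA, h1, measure_union h2 hPm.neg, Measure.measure_neg, ← two_mul,
    ← mul_assoc, ENNReal.inv_mul_cancel two_ne_zero ENNReal.ofNat_ne_top, one_mul]

omit [FiniteDimensional ℝ V] in
theorem chartLiouville_apply {S : Set (spDual B)} {U : Set (Fin k × Fin 2 → ℝ)}
    {φ : (Fin k × Fin 2 → ℝ) → spDual B} (h : IsLocalParam S U φ) {A : Set (spDual B)}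
    (hA : MeasurableSet A) :
    chartLiouville B U φ A = ∫⁻ x in U ∩ φ ⁻¹' A, ENNReal.ofReal
        (|wedgePow k
            (fun a b : Fin k × Fin 2 → ℝ => kksForm (φ x) (fderiv ℝ φ x a) (fderiv ℝ φ x b))
            (fun p => Pi.single p (1 : ℝ))| / (Nat.factorial k : ℝ)) := by
  have hU := h.isOpen.measurableSet
  have hc := h.contDiffOn.continuousOn
  -- Nothing is known of `φ` outside `U`, so only almost everywhere measurability for the restricted
  -- measure is available.
  have hm : AEMeasurable φ (volume.restrict U) := hc.aemeasurable hU
  rw [chartLiouville, Measure.map_apply_of_aemeasurable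
    (hm.mono_ac (withDensity_absolutelyContinuous _ _)) hA,
    ← restrict_withDensity hU, Measure.restrict_apply' hU, Set.inter_comm,
    withDensity_apply _ (measurableSet_inter_preimage hU hc hA)]

/-- The density of the Liouville measure in a local parametrization. -/
theorem wedgePow_kksForm (hB : B.IsAlt) (hnd : B.Nondegenerate)
    {b : Module.Basis (Fin k × Fin 2) ℝ V} (hb : IsSymplecticBasis B b)
    {φ : (Fin k × Fin 2 → ℝ) → spDual B} {θ : (Fin k × Fin 2 → ℝ) → (Fin k × Fin 2 → ℝ)}
    {D : (Fin k × Fin 2 → ℝ) →L[ℝ] (Fin k × Fin 2 → ℝ)} {x : Fin k × Fin 2 → ℝ}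
    (hθ : HasFDerivAt θ D x) (hx : coordEquiv b (θ x) ≠ 0)
    (hφ : ∀ᶠ y in nhds x, φ y = moment B (coordEquiv b (θ y))) :
    |wedgePow k (fun a c : Fin k × Fin 2 → ℝ => kksForm (φ x) (fderiv ℝ φ x a) (fderiv ℝ φ x c))
        (fun p => Pi.single p (1 : ℝ))| / (Nat.factorial k : ℝ) = |D.det| := by
  have h1 : HasFDerivAt φ ((momentDeriv B (coordEquiv b (θ x))).comp
      (((coordEquiv b : (Fin k × Fin 2 → ℝ) →L[ℝ] V)).comp D)) x := by
    have hθ' : HasFDerivAt (fun y => coordEquiv b (θ y))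
        ((coordEquiv b : (Fin k × Fin 2 → ℝ) →L[ℝ] V).comp D) x :=
      (coordEquiv b : (Fin k × Fin 2 → ℝ) →L[ℝ] V).hasFDerivAt.comp x hθ
    have hm := HasFDerivAt.comp x (hasFDerivAt_moment (B := B) (coordEquiv b (θ x))) hθ'
    exact hm.congr_of_eventuallyEq hφ
  have h2 : (fun a c : Fin k × Fin 2 → ℝ =>
      kksForm (φ x) (fderiv ℝ φ x a) (fderiv ℝ φ x c)) =
      fun a c => B (b.equivFun.symm (D a)) (b.equivFun.symm (D c)) := by
    ext a c
    rw [h1.fderiv, hφ.self_of_nhds]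
    exact kksForm_momentDeriv hB hnd hx _ _
  have h3 := wedgePow_comp B b (D : (Fin k × Fin 2 → ℝ) →ₗ[ℝ] (Fin k × Fin 2 → ℝ))
  simp only [ContinuousLinearMap.coe_coe] at h3
  rw [h2, h3, wedgePow_symplecticBasis hB hb, abs_mul, Nat.abs_cast,
    mul_div_cancel_right₀ _ (Nat.cast_ne_zero.2 (Nat.factorial_ne_zero k))]

/-- The section lifts the chart to a smooth injective `θ` with `φ = moment ∘ θ` in symplectic
coordinates. The density of the chart is `|det Dθ|`, so the change of variables gives the volume of
`θ(W)`, the positive sheet over `A ∩ φ(U)`. -/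
theorem chartLiouville_apply_of_subset_posSet (hB : B.IsAlt) (hnd : B.Nondegenerate)
    {b : Module.Basis (Fin k × Fin 2) ℝ V} (hb : IsSymplecticBasis B b)
    {U : Set (Fin k × Fin 2 → ℝ)} {φ : (Fin k × Fin 2 → ℝ) → spDual B}
    (h : IsLocalParam (momentOrbit B) U φ) (u : V) {A : Set (spDual B)} (hA : MeasurableSet A)
    (hu : A ⊆ posSet hB u) :
    chartLiouville B U φ A = momentMeasure B b (A ∩ φ '' U) := by
  set θ : (Fin k × Fin 2 → ℝ) → (Fin k × Fin 2 → ℝ) :=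
    fun x => (coordEquiv b).symm (momentSection hB hnd u (φ x)) with hθ
  set W := U ∩ φ ⁻¹' A with hW
  have hc := h.contDiffOn.continuousOn
  have hWm : MeasurableSet W := measurableSet_inter_preimage h.isOpen.measurableSet hc hA
  have hmom (x) (hx : x ∈ U) (hx' : φ x ∈ posSet hB u) :
      moment B (coordEquiv b (θ x)) = φ x := by
    rw [hθ, ContinuousLinearEquiv.apply_symm_apply]
    exact moment_momentSection hB hnd (h.mapsTo hx) hx'
  have hpos (x) (hx : x ∈ U) (hx' : φ x ∈ posSet hB u) : 0 < B u (coordEquiv b (θ x)) := by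
    rw [hθ, ContinuousLinearEquiv.apply_symm_apply]
    exact apply_momentSection_pos hB hnd (h.mapsTo hx) hx'
  have hopen : IsOpen (U ∩ φ ⁻¹' posSet hB u) := hc.isOpen_inter_preimage h.isOpen
    (isOpen_posSet hB u)
  have hdiff : ContDiffOn ℝ ∞ θ (U ∩ φ ⁻¹' posSet hB u) :=
    (coordEquiv b).symm.contDiff.comp_contDiffOn
      ((contDiffOn_momentSection hB hnd u).comp (h.contDiffOn.mono Set.inter_subset_left)
        fun x hx => hx.2)
  have hder (x) (hx : x ∈ W) : HasFDerivAt θ (fderiv ℝ θ x) x :=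
    ((hdiff.contDiffAt (hopen.mem_nhds ⟨hx.1, hu hx.2⟩)).differentiableAt
      (by simp)).hasFDerivAt
  have hinj : Set.InjOn θ W := by
    intro x hx y hy hxy
    have h1 : φ x = φ y := by
      rw [← hmom x hx.1 (hu hx.2), ← hmom y hy.1 (hu hy.2), hxy]
    have h2 : h.mapsTo.restrict φ U (momentOrbit B) ⟨x, hx.1⟩ =
        h.mapsTo.restrict φ U (momentOrbit B) ⟨y, hy.1⟩ := Subtype.ext h1
    exact congrArg Subtype.val (h.isOpenEmbedding.injective h2)
  have himage : θ '' W = {x | 0 < B u (coordEquiv b x) ∧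
      moment B (coordEquiv b x) ∈ A ∩ φ '' U} := by
    ext y
    constructor
    · rintro ⟨x, hx, rfl⟩
      refine ⟨hpos x hx.1 (hu hx.2), ?_⟩
      rw [hmom x hx.1 (hu hx.2)]
      exact ⟨hx.2, x, hx.1, rfl⟩
    · rintro ⟨hy, hyA, x, hx, hxy⟩
      refine ⟨x, ⟨hx, by rwa [Set.mem_preimage, hxy]⟩, ?_⟩
      rw [hθ]
      simp only
      rw [hxy, momentSection_moment hB hnd hy, ContinuousLinearEquiv.symm_apply_apply]
  rw [chartLiouville_apply h hA, momentMeasure_apply_of_subset_posSet hB b u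
    (hA.inter (h.measurableSet_image (measurableSet_momentOrbit hB hnd)))
    (Set.inter_subset_left.trans hu), ← himage,
    ← lintegral_abs_det_fderiv_eq_addHaar_image volume hWm
      (fun x hx => (hder x hx).hasFDerivWithinAt) hinj]
  refine setLIntegral_congr_fun hWm fun x hx => ?_
  rw [wedgePow_kksForm hB hnd hb (hder x hx)]
  · intro h0
    have := hpos x hx.1 (hu hx.2)
    rw [h0, map_zero] at this
    exact lt_irrefl _ this
  · filter_upwards [hopen.mem_nhds ⟨hx.1, hu hx.2⟩] with y hy
    exact (hmom y hy.1 hy.2).symm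

theorem exists_mem_posSet (hB : B.IsAlt) (hnd : B.Nondegenerate) {ι : Type*}
    (b : Module.Basis ι ℝ V) {f : spDual B} (hf : f ∈ momentOrbit B) :
    ∃ i, f ∈ posSet hB (b i) := by
  obtain ⟨v, hv, rfl⟩ := exists_moment_eq hf
  simp only [moment_mem_posSet]
  by_contra! h
  refine hv (hnd.2 v fun x => ?_)
  have : B.flip v = 0 := b.ext fun i => by simpa using h i
  simpa using LinearMap.congr_fun this x

/-- Two measures on `sp(V)^*` agree if they agree near the points of the orbit, and off the
orbit. -/
theorem measure_ext_of_momentOrbit (hB : B.IsAlt) (hnd : B.Nondegenerate)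
    (b : Module.Basis (Fin k × Fin 2) ℝ V) {μ ν : Measure (spDual B)}
    (h0 : μ (momentOrbit B)ᶜ = ν (momentOrbit B)ᶜ) (h0' : ν (momentOrbit B)ᶜ = 0)
    (h : ∀ i, ∀ A ⊆ momentOrbit B, MeasurableSet A → A ⊆ posSet hB (b i) → μ A = ν A) :
    μ = ν := by
  have hS := measurableSet_momentOrbit hB hnd
  refine Measure.ext_of_iUnion_eq_univ (s := fun o : Option (Fin k × Fin 2) =>
    o.elim (momentOrbit B)ᶜ fun i => momentOrbit B ∩ posSet hB (b i)) ?_ ?_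
  · refine Set.eq_univ_of_forall fun f => Set.mem_iUnion.2 ?_
    by_cases hf : f ∈ momentOrbit B
    · obtain ⟨i, hi⟩ := exists_mem_posSet hB hnd b hf
      exact ⟨some i, hf, hi⟩
    · exact ⟨none, hf⟩
  · rintro (_ | i)
    · change μ.restrict (momentOrbit B)ᶜ = ν.restrict (momentOrbit B)ᶜ
      rw [Measure.restrict_eq_zero.2 h0', Measure.restrict_eq_zero.2 (h0.trans h0')]
    · refine Measure.ext fun A hA => ?_
      rw [Measure.restrict_apply hA, Measure.restrict_apply hA]
      exact h i _ (fun x hx => hx.2.1)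
        (hA.inter (hS.inter (isOpen_posSet hB (b i)).measurableSet)) fun x hx => hx.2.2

theorem chartLiouville_eq_restrict (hB : B.IsAlt) (hnd : B.Nondegenerate)
    {b : Module.Basis (Fin k × Fin 2) ℝ V} (hb : IsSymplecticBasis B b)
    {U : Set (Fin k × Fin 2 → ℝ)} {φ : (Fin k × Fin 2 → ℝ) → spDual B}
    (h : IsLocalParam (momentOrbit B) U φ) :
    chartLiouville B U φ = (momentMeasure B b).restrict (φ '' U) := by
  have hS := measurableSet_momentOrbit hB hnd
  have h0 : (momentMeasure B b).restrict (φ '' U) (momentOrbit B)ᶜ = 0 := by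
    rw [Measure.restrict_apply hS.compl]
    have : (momentOrbit B)ᶜ ∩ φ '' U = ∅ := by
      ext f
      simp only [Set.mem_inter_iff, Set.mem_empty_iff_false, iff_false, not_and]
      rintro hf ⟨x, hx, rfl⟩
      exact hf (h.mapsTo hx)
    rw [this, measure_empty]
  refine measure_ext_of_momentOrbit hB hnd b ?_ h0 fun i A _ hA hAi => ?_
  · have : U ∩ φ ⁻¹' (momentOrbit B)ᶜ = ∅ := by
      ext x
      simp only [Set.mem_inter_iff, Set.mem_empty_iff_false, iff_false, not_and]
      exact fun hx hx' => hx' (h.mapsTo hx)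
    rw [h0, chartLiouville_apply h hS.compl, this]
    simp
  · rw [chartLiouville_apply_of_subset_posSet hB hnd hb h _ hA hAi, Measure.restrict_apply hA]

/-- Only the origin is sent outside `Ω`, and a point is null in positive dimension. -/
theorem momentMeasure_compl [Nontrivial V] (hB : B.IsAlt) (hnd : B.Nondegenerate)
    (b : Module.Basis (Fin k × Fin 2) ℝ V) : momentMeasure B b (momentOrbit B)ᶜ = 0 := by
  have hn : Nontrivial (Fin k × Fin 2 → ℝ) := (coordEquiv b).toEquiv.nontrivial
  rw [momentMeasure_apply b (measurableSet_momentOrbit hB hnd).compl]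
  have : {x | moment B (coordEquiv b x) ∈ (momentOrbit B)ᶜ} ⊆ {0} := fun x hx => by
    by_contra h0
    exact hx (moment_mem_momentOrbit hB hnd (by simpa using h0))
  rw [measure_mono_null this (measure_singleton _), mul_zero]

theorem orbitLiouville_le (hB : B.IsAlt) (hnd : B.Nondegenerate)
    {b : Module.Basis (Fin k × Fin 2) ℝ V} (hb : IsSymplecticBasis B b) :
    orbitLiouville B k (momentOrbit B) ≤ momentMeasure B b := by
  refine sSup_le ?_
  rintro _ ⟨U, φ, h, rfl⟩
  rw [chartLiouville_eq_restrict hB hnd hb h]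
  exact Measure.restrict_le_self

/-- All chart measures are restrictions of the single measure `momentMeasure`. It therefore bounds
their supremum from above, while each chart measure bounds it from below. -/
theorem restrict_orbitLiouville_eq (hB : B.IsAlt) (hnd : B.Nondegenerate)
    {b : Module.Basis (Fin k × Fin 2) ℝ V} (hb : IsSymplecticBasis B b)
    {U : Set (Fin k × Fin 2 → ℝ)} {φ : (Fin k × Fin 2 → ℝ) → spDual B}
    (h : IsLocalParam (momentOrbit B) U φ) :
    (orbitLiouville B k (momentOrbit B)).restrict (φ '' U) = chartLiouville B U φ := by
  have h1 := chartLiouville_eq_restrict hB hnd hb h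
  have hm := h.measurableSet_image (measurableSet_momentOrbit hB hnd)
  apply le_antisymm
  · rw [h1]
    exact Measure.restrict_mono le_rfl (orbitLiouville_le hB hnd hb)
  · have h2 : (chartLiouville B U φ).restrict (φ '' U) = chartLiouville B U φ := by
      rw [h1, Measure.restrict_restrict hm, Set.inter_self]
    rw [← h2]
    exact Measure.restrict_mono le_rfl (le_sSup ⟨U, φ, h, rfl⟩)

/-- The Liouville measure of the orbit is half of the image of that of `V`. -/
theorem orbitLiouville_eq [Nontrivial V] (hB : B.IsAlt) (hnd : B.Nondegenerate)
    {b : Module.Basis (Fin k × Fin 2) ℝ V} (hb : IsSymplecticBasis B b) :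
    orbitLiouville B k (momentOrbit B) = momentMeasure B b := by
  have h0 := momentMeasure_compl hB hnd b
  refine measure_ext_of_momentOrbit hB hnd b ?_ h0 fun i A hAS hA hAi => ?_
  · exact le_antisymm (orbitLiouville_le hB hnd hb _) (by rw [h0]; exact zero_le)
  -- The half-space chart covers the part of `Ω` in `posSet hB (b i)`, so the supremum attains the
  -- upper bound there.
  · have h := isLocalParam_moment hB hnd (b i) (coordEquiv b)
    have hsub : A ⊆ (fun x => moment B (coordEquiv b x)) '' {x | 0 < B (b i) (coordEquiv b x)} := by
      intro f hf
      obtain ⟨v, hv, rfl⟩ := exists_pos_moment_eq hB (hAS hf) (hAi hf)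
      exact ⟨(coordEquiv b).symm v, by simpa using hv, by simp⟩
    have h1 := restrict_orbitLiouville_eq hB hnd hb h
    rw [chartLiouville_eq_restrict hB hnd hb h] at h1
    rw [← Measure.restrict_eq_self _ hsub, h1, Measure.restrict_eq_self _ hsub]

end Liouville

/-! ### Decay of the Fourier transform of a test function -/

section Fourier

open scoped FourierTransform

variable {E : Type*} [NormedAddCommGroup E] [NormedSpace ℝ E] [FiniteDimensional ℝ E]
  [MeasurableSpace E] [BorelSpace E] {lam : Measure E} [lam.IsAddHaarMeasure] {ι : ℂ}

/-- The Fourier transform of the density `ψ(X) dX`, as a function on the dual space. -/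
def dualFourier (ι : ℂ) (lam : Measure E) (ψ : E → ℂ) (f : E →L[ℝ] ℝ) : ℂ :=
  ∫ X, ψ X * Complex.exp (ι * ((f X : ℝ) : ℂ)) ∂lam

theorem exists_eq_mul_I (hι : ι ^ 2 = -1) : ∃ s : ℝ, |s| = 1 ∧ ι = s * Complex.I := by
  have : (ι - Complex.I) * (ι + Complex.I) = 0 := by
    linear_combination hι - Complex.I_sq
  rcases mul_eq_zero.1 this with h | h
  · exact ⟨1, by simp, by simpa using sub_eq_zero.1 h⟩
  · exact ⟨-1, by simp, by simpa using eq_neg_of_add_eq_zero_left h⟩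

omit [FiniteDimensional ℝ E] [BorelSpace E] [lam.IsAddHaarMeasure] in
-- The factor `-(s / 2π)` converts the exponent `s i f(X)` to the convention `exp (-2π i ⟨X, w⟩)`.
theorem dualFourier_eq (s : ℝ) (ψ : E → ℂ) (f : E →L[ℝ] ℝ) :
    dualFourier (s * Complex.I) lam ψ f =
      VectorFourier.fourierIntegral 𝐞 lam (ContinuousLinearMap.apply ℝ ℝ :
        E →L[ℝ] (E →L[ℝ] ℝ) →L[ℝ] ℝ).toLinearMap₁₂ ψ (-(s / (2 * Real.pi)) • f) := by
  rw [dualFourier, VectorFourier.fourierIntegral]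
  refine integral_congr_ae (Filter.Eventually.of_forall fun X => ?_)
  have hL : (ContinuousLinearMap.apply ℝ ℝ : E →L[ℝ] (E →L[ℝ] ℝ) →L[ℝ] ℝ).toLinearMap₁₂ X
      (-(s / (2 * Real.pi)) • f) = -(s / (2 * Real.pi)) * f X := rfl
  beta_reduce
  rw [hL]
  simp only [smul_eq_mul, Circle.smul_def, Real.fourierChar_apply]
  rw [mul_comm]
  congr 2
  push_cast
  have : (Real.pi : ℂ) ≠ 0 := by exact_mod_cast Real.pi_ne_zero
  field_simp

omit [FiniteDimensional ℝ E] in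
theorem integrable_iteratedFDeriv {ψ : E → ℂ} (hψ : ContDiff ℝ ∞ ψ) (hc : HasCompactSupport ψ)
    (n : ℕ) : Integrable (iteratedFDeriv ℝ n ψ) lam :=
  (hψ.continuous_iteratedFDeriv (by exact_mod_cast le_top)).integrable_of_hasCompactSupport
    (hc.iteratedFDeriv n)

/-- Integration by parts along a direction `v` in which `f` reaches half of its norm. The constant
`8π` combines the `2π` of the normalization, the lost factor `2`, and the `2^n` of the derivative
estimate. -/
theorem pow_norm_mul_dualFourier_le (hι : ι ^ 2 = -1) {ψ : E → ℂ} (hψ : ContDiff ℝ ∞ ψ)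
    (hc : HasCompactSupport ψ) (n : ℕ) (f : E →L[ℝ] ℝ) :
    ‖f‖ ^ n * ‖dualFourier ι lam ψ f‖ ≤
      (8 * Real.pi) ^ n * ∑ j ∈ Finset.range (n + 1), ∫ X, ‖iteratedFDeriv ℝ j ψ X‖ ∂lam := by
  obtain ⟨s, hs, rfl⟩ := exists_eq_mul_I hι
  obtain ⟨v, hv, hfv⟩ : ∃ v : E, ‖v‖ ≤ 1 ∧ ‖f‖ / 2 ≤ |f v| := by
    by_cases hf : ‖f‖ = 0
    · exact ⟨0, by simp, by simp [hf]⟩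
    · have : ‖f‖ / 2 < ‖f‖ := half_lt_self ((norm_nonneg f).lt_of_ne' hf)
      obtain ⟨v, hv, h⟩ := f.exists_lt_apply_of_lt_opNorm this
      exact ⟨v, hv.le, h.le⟩
  have h := VectorFourier.pow_mul_norm_iteratedFDeriv_fourierIntegral_le (μ := lam)
    (ContinuousLinearMap.apply ℝ ℝ : E →L[ℝ] (E →L[ℝ] ℝ) →L[ℝ] ℝ) (f := ψ) (K := 0) (N := ⊤)
    hψ (fun k m hk _ => by
      obtain rfl : k = 0 := by simpa using hk
      simpa using (integrable_iteratedFDeriv hψ hc m).norm) (k := 0) (n := n) le_rfl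
    (by simp) v (-(s / (2 * Real.pi)) • f)
  rw [norm_iteratedFDeriv_zero, ← dualFourier_eq] at h
  simp only [pow_zero, mul_one, Nat.cast_zero, mul_zero, zero_add, Finset.range_one,
    Finset.singleton_product, Finset.sum_map, Function.Embedding.coeFn_mk, one_mul,
    ContinuousLinearMap.apply_apply, smul_apply, smul_eq_mul, abs_mul, abs_neg, abs_div, hs,
    abs_of_pos Real.two_pi_pos] at h
  have hpi := Real.pi_pos
  set F := ‖dualFourier (s * Complex.I) lam ψ f‖
  set S := ∑ j ∈ Finset.range (n + 1), ∫ X, ‖iteratedFDeriv ℝ j ψ X‖ ∂lam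
  have hS : 0 ≤ S := Finset.sum_nonneg fun _ _ => integral_nonneg fun _ => norm_nonneg _
  have hF : 0 ≤ F := norm_nonneg _
  calc ‖f‖ ^ n * F = (4 * Real.pi) ^ n * ((1 / (2 * Real.pi) * (‖f‖ / 2)) ^ n * F) := by
        rw [← mul_assoc, ← mul_pow]
        congr 2
        field_simp
        norm_num
    _ ≤ (4 * Real.pi) ^ n * ((1 / (2 * Real.pi) * |f v|) ^ n * F) := by gcongr
    _ ≤ (4 * Real.pi) ^ n * (‖v‖ ^ n * 2 ^ n * S) := by gcongr
    _ ≤ (4 * Real.pi) ^ n * (1 ^ n * 2 ^ n * S) := by gcongr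
    _ = (8 * Real.pi) ^ n * S := by
        rw [one_pow, one_mul, ← mul_assoc, ← mul_pow]
        congr 2
        ring

omit [FiniteDimensional ℝ E] in
theorem integrable_mul_exp {ψ : E → ℂ} (hψ : Continuous ψ)
    (hc : HasCompactSupport ψ) (f : E →L[ℝ] ℝ) :
    Integrable (fun X => ψ X * Complex.exp (ι * ((f X : ℝ) : ℂ))) lam :=
  (by fun_prop : Continuous fun X => ψ X * Complex.exp (ι * ((f X : ℝ) : ℂ))
    ).integrable_of_hasCompactSupport hc.mul_right

omit [FiniteDimensional ℝ E] in
theorem continuous_dualFourier (hι : ι ^ 2 = -1) {ψ : E → ℂ} (hψ : Continuous ψ)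
    (hc : HasCompactSupport ψ) : Continuous (dualFourier ι lam ψ) := by
  obtain ⟨s, -, rfl⟩ := exists_eq_mul_I hι
  have h := VectorFourier.fourierIntegral_continuous (μ := lam) Real.continuous_fourierChar
    (L := (ContinuousLinearMap.apply ℝ ℝ : E →L[ℝ] (E →L[ℝ] ℝ) →L[ℝ] ℝ).toLinearMap₁₂)
    (by
      change Continuous fun p : E × (E →L[ℝ] ℝ) => p.2 p.1
      fun_prop) (hψ.integrable_of_hasCompactSupport hc)
  rw [show dualFourier (s * Complex.I) lam ψ = _ from funext (dualFourier_eq s ψ)]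
  exact h.comp (continuous_const_smul _)

end Fourier

/-! ### Integrals over the symplectic space as distributions -/

section Oscillatory

variable {V : Type*} [NormedAddCommGroup V] [NormedSpace ℝ V] [FiniteDimensional ℝ V]
  [MeasurableSpace V] [BorelSpace V] {B : LinearMap.BilinForm ℝ V}
  {lam : Measure (sp B)} [lam.IsAddHaarMeasure] {ι : ℂ}

/-- The sum of the `L¹` norms of the derivatives of order at most `n`. -/
def derivNorm (lam : Measure (sp B)) (n : ℕ) (ψ : sp B → ℂ) : ℝ :=
  ∑ j ∈ Finset.range (n + 1), ∫ X, ‖iteratedFDeriv ℝ j ψ X‖ ∂lam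

omit [FiniteDimensional ℝ V] [MeasurableSpace V] [BorelSpace V] [lam.IsAddHaarMeasure] in
theorem derivNorm_mono {m n : ℕ} (h : m ≤ n) (ψ : sp B → ℂ) :
    derivNorm lam m ψ ≤ derivNorm lam n ψ :=
  Finset.sum_le_sum_of_subset_of_nonneg (Finset.range_mono (by omega))
    fun _ _ _ => integral_nonneg fun _ => norm_nonneg _

omit [MeasurableSpace V] [BorelSpace V] in
-- The decay estimates of orders `0` and `N` are added; the quadratic growth of `moment` turns order
-- `N` in `f` into order `2N` in `v`.
theorem exists_norm_dualFourier_moment_le (hB : B.IsAlt) (hnd : B.Nondegenerate)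
    (hι : ι ^ 2 = -1) (lam : Measure (sp B)) [lam.IsAddHaarMeasure] (N : ℕ) :
    ∃ C ≥ 0, ∀ ψ : sp B → ℂ, ContDiff ℝ ∞ ψ → HasCompactSupport ψ → ∀ v : V,
      ‖dualFourier ι lam ψ (moment B v)‖ ≤
        C * derivNorm lam N ψ * (1 + ‖v‖ ^ 2) ^ (-(2 * N : ℝ) / 2) := by
  obtain ⟨c, hc0, hc⟩ := exists_mul_sq_le_norm_moment hB hnd
  have hpi := Real.pi_pos
  refine ⟨2 ^ (N - 1) * (1 + (8 * Real.pi / c) ^ N), by positivity, fun ψ hψ hψc v => ?_⟩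
  set F := ‖dualFourier ι lam ψ (moment B v)‖
  have hF : 0 ≤ F := norm_nonneg _
  have h0 : F ≤ derivNorm lam N ψ := by
    have := pow_norm_mul_dualFourier_le (lam := lam) hι hψ hψc 0 (moment B v)
    rw [pow_zero, pow_zero, one_mul, one_mul] at this
    exact this.trans (derivNorm_mono (Nat.zero_le N) ψ)
  have h1 : (‖v‖ ^ 2) ^ N * F ≤ (8 * Real.pi / c) ^ N * derivNorm lam N ψ := by
    have h := pow_norm_mul_dualFourier_le (lam := lam) hι hψ hψc N (moment B v)
    rw [div_pow, div_mul_eq_mul_div, le_div_iff₀ (by positivity)]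
    calc (‖v‖ ^ 2) ^ N * F * c ^ N = (c * ‖v‖ ^ 2) ^ N * F := by rw [mul_pow]; ring
      _ ≤ ‖moment B v‖ ^ N * F := by gcongr; exact hc v
      _ ≤ _ := h
  have hrpow : (1 + ‖v‖ ^ 2) ^ (-(2 * N : ℝ) / 2) = ((1 + ‖v‖ ^ 2) ^ N)⁻¹ := by
    rw [neg_div, mul_div_cancel_left₀ _ (two_ne_zero' ℝ), Real.rpow_neg (by positivity),
      Real.rpow_natCast]
  rw [hrpow, ← div_eq_mul_inv, le_div_iff₀ (by positivity)]
  calc F * (1 + ‖v‖ ^ 2) ^ N ≤ F * (2 ^ (N - 1) * (1 ^ N + (‖v‖ ^ 2) ^ N)) := by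
        gcongr
        exact add_pow_le zero_le_one (by positivity) N
    _ = 2 ^ (N - 1) * (F + (‖v‖ ^ 2) ^ N * F) := by ring
    _ ≤ 2 ^ (N - 1) * (derivNorm lam N ψ + (8 * Real.pi / c) ^ N * derivNorm lam N ψ) := by
        gcongr
    _ = _ := by ring

theorem exists_integral_dualFourier_moment_le (hB : B.IsAlt) (hnd : B.Nondegenerate)
    (hι : ι ^ 2 = -1) (lam : Measure (sp B)) [lam.IsAddHaarMeasure] (μ : Measure V)
    [μ.IsAddHaarMeasure] :
    ∃ (N : ℕ) (C : ℝ), 0 ≤ C ∧ ∀ ψ : sp B → ℂ, ContDiff ℝ ∞ ψ → HasCompactSupport ψ →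
      Integrable (fun v => dualFourier ι lam ψ (moment B v)) μ ∧
      ‖∫ v, dualFourier ι lam ψ (moment B v) ∂μ‖ ≤ C * derivNorm lam N ψ := by
  -- Integrability of the majorant needs `2N` to exceed the dimension.
  set N := Module.finrank ℝ V + 1 with hN
  obtain ⟨C, hC, h⟩ := exists_norm_dualFourier_moment_le hB hnd hι lam N
  have hint : Integrable (fun v : V => ((1 : ℝ) + ‖v‖ ^ 2) ^ (-(2 * N : ℝ) / 2)) μ :=
    integrable_rpow_neg_one_add_norm_sq (by rw [hN]; push_cast; linarith)
  refine ⟨N, C * ∫ v : V, ((1 : ℝ) + ‖v‖ ^ 2) ^ (-(2 * N : ℝ) / 2) ∂μ, ?_, fun ψ hψ hψc =>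
    ⟨?_, ?_⟩⟩
  · exact mul_nonneg hC (integral_nonneg fun v => by positivity)
  · exact (hint.const_mul (C * derivNorm lam N ψ)).mono'
      ((continuous_dualFourier hι hψ.continuous hψc).comp
        continuous_moment).aestronglyMeasurable (Filter.Eventually.of_forall (h ψ hψ hψc))
  · calc ‖∫ v, dualFourier ι lam ψ (moment B v) ∂μ‖
        ≤ ∫ v : V, C * derivNorm lam N ψ * ((1 : ℝ) + ‖v‖ ^ 2) ^ (-(2 * N : ℝ) / 2) ∂μ :=
          norm_integral_le_of_norm_le (hint.const_mul _)
            (Filter.Eventually.of_forall (h ψ hψ hψc))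
      _ = _ := by rw [integral_const_mul]; ring

omit [FiniteDimensional ℝ V] [MeasurableSpace V] [BorelSpace V] in
theorem integral_norm_iteratedFDeriv_le {K : TopologicalSpace.Compacts (sp B)}
    (ψ : 𝓓_{K}(sp B, ℂ)) (j : ℕ) :
    ∫ X, ‖iteratedFDeriv ℝ j ψ X‖ ∂lam ≤
      lam.real K * ContDiffMapSupportedIn.seminorm ℂ (sp B) ℂ ⊤ K j ψ := by
  have h1 : ∫ X, ‖iteratedFDeriv ℝ j ψ X‖ ∂lam = ∫ X in K, ‖iteratedFDeriv ℝ j ψ X‖ ∂lam := by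
    refine (setIntegral_eq_integral_of_forall_compl_eq_zero fun X hX => ?_).symm
    rw [ψ.iteratedFDeriv_zero_on_compl hX, Pi.zero_apply, norm_zero]
  rw [h1, mul_comm]
  have h2 := norm_setIntegral_le_of_norm_le_const (μ := lam) (s := (K : Set (sp B)))
    (f := fun X => ‖iteratedFDeriv ℝ j ψ X‖)
    (C := ContDiffMapSupportedIn.seminorm ℂ (sp B) ℂ ⊤ K j ψ) K.isCompact.measure_lt_top
    (fun X _ => by
      rw [norm_norm]
      exact ContDiffMapSupportedIn.norm_iteratedFDeriv_apply_le_seminorm_top ℂ)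
  exact (Real.le_norm_self _).trans h2

omit [FiniteDimensional ℝ V] [MeasurableSpace V] [BorelSpace V] in
-- Gives continuity on the test functions supported in `K`, through the seminorms defining their
-- topology.
theorem derivNorm_le {K : TopologicalSpace.Compacts (sp B)} (ψ : 𝓓_{K}(sp B, ℂ)) (n : ℕ) :
    derivNorm lam n ψ ≤ ((n + 1) * lam.real K) *
      ((Finset.range (n + 1)).sup
        fun i => ContDiffMapSupportedIn.seminorm ℂ (sp B) ℂ ⊤ K i) ψ := by
  have h (j : ℕ) (hj : j ∈ Finset.range (n + 1)) : ∫ X, ‖iteratedFDeriv ℝ j ψ X‖ ∂lam ≤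
      lam.real K * ((Finset.range (n + 1)).sup
        fun i => ContDiffMapSupportedIn.seminorm ℂ (sp B) ℂ ⊤ K i) ψ :=
    (integral_norm_iteratedFDeriv_le ψ j).trans (mul_le_mul_of_nonneg_left
      (Seminorm.le_def.1 (Finset.le_sup
        (f := fun i => ContDiffMapSupportedIn.seminorm ℂ (sp B) ℂ ⊤ K i) hj) ψ)
      measureReal_nonneg)
  refine (Finset.sum_le_sum h).trans_eq ?_
  rw [Finset.sum_const, Finset.card_range, nsmul_eq_mul]
  push_cast
  ring

omit [FiniteDimensional ℝ V] [MeasurableSpace V] [BorelSpace V] in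
theorem dualFourier_add {ψ χ : sp B → ℂ} (hψ : Continuous ψ)
    (hψc : HasCompactSupport ψ) (hχ : Continuous χ) (hχc : HasCompactSupport χ)
    (f : spDual B) :
    dualFourier ι lam (fun X => ψ X + χ X) f = dualFourier ι lam ψ f + dualFourier ι lam χ f := by
  simp only [dualFourier, add_mul]
  exact integral_add (integrable_mul_exp hψ hψc f) (integrable_mul_exp hχ hχc f)

omit [FiniteDimensional ℝ V] [MeasurableSpace V] [BorelSpace V] [lam.IsAddHaarMeasure] in
theorem dualFourier_smul (c : ℂ) (ψ : sp B → ℂ) (f : spDual B) :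
    dualFourier ι lam (fun X => c * ψ X) f = c * dualFourier ι lam ψ f := by
  simp only [dualFourier, mul_assoc]
  exact integral_const_mul c _

/-- The iterated oscillatory integral is a distribution on `sp(V)`. -/
theorem exists_distribution (hB : B.IsAlt) (hnd : B.Nondegenerate)
    (hι : ι ^ 2 = -1) (lam : Measure (sp B)) [lam.IsAddHaarMeasure] (μ : Measure V)
    [μ.IsAddHaarMeasure] :
    ∃ T : 𝓓((⊤ : TopologicalSpace.Opens (sp B)), ℂ) →L[ℂ] ℂ,
      ∀ ψ : 𝓓((⊤ : TopologicalSpace.Opens (sp B)), ℂ),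
        Integrable (fun v => dualFourier ι lam ψ (moment B v)) μ ∧
        T ψ = ∫ v, dualFourier ι lam ψ (moment B v) ∂μ := by
  obtain ⟨N, C, hC, h⟩ := exists_integral_dualFourier_moment_le hB hnd hι lam μ
  let TK (K : TopologicalSpace.Compacts (sp B)) : 𝓓_{K}(sp B, ℂ) →L[ℂ] ℂ :=
    ContDiffMapSupportedIn.mkCLMtoNormedSpace ℂ
      (fun ψ => ∫ v, dualFourier ι lam ψ (moment B v) ∂μ)
      (fun ψ χ => by
        rw [← integral_add (h ψ ψ.contDiff ψ.hasCompactSupport).1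
          (h χ χ.contDiff χ.hasCompactSupport).1]
        refine integral_congr_ae (Filter.Eventually.of_forall fun v => ?_)
        exact dualFourier_add ψ.continuous ψ.hasCompactSupport χ.continuous
          χ.hasCompactSupport _)
      (fun c ψ => by
        rw [smul_eq_mul, ← integral_const_mul]
        refine integral_congr_ae (Filter.Eventually.of_forall fun v => ?_)
        exact dualFourier_smul c ψ _)
      ⟨Finset.range (N + 1), C * ((N + 1) * lam.real K), by positivity, fun ψ => by
        rw [mul_assoc]
        exact (h ψ ψ.contDiff ψ.hasCompactSupport).2.trans
          (mul_le_mul_of_nonneg_left (derivNorm_le ψ N) hC)⟩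
  -- The test functions carry an inductive limit topology, so continuity on each fixed compact
  -- support suffices.
  refine ⟨TestFunction.limitCLM ℂ (fun ψ => ∫ v, dualFourier ι lam ψ (moment B v) ∂μ)
    (fun K _ => TK K) (fun K _ ψ => rfl), fun ψ =>
    ⟨(h ψ ψ.contDiff ψ.hasCompactSupport).1, rfl⟩⟩

/-! ### Comparison of the two integrals -/

variable {k : ℕ}

theorem addHaar_eq_map (b : Module.Basis (Fin k × Fin 2) ℝ V) :
    b.addHaar = Measure.map (coordEquiv b) volume := by
  have h : (volume : Measure (Fin k × Fin 2 → ℝ)) =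
      (Pi.basisFun ℝ (Fin k × Fin 2)).addHaar := by
    rw [← addHaarMeasure_eq_volume_pi, ← Module.Basis.parallelepiped_basisFun,
      ← Module.Basis.addHaar]
  rw [h, Module.Basis.map_addHaar]
  congr 1
  ext p
  simp [coordEquiv_apply]

theorem momentMeasure_eq (b : Module.Basis (Fin k × Fin 2) ℝ V) :
    momentMeasure B b = (2 : ENNReal)⁻¹ • Measure.map (moment B) b.addHaar := by
  rw [addHaar_eq_map, Measure.map_map continuous_moment.measurable
    (coordEquiv b).continuous.measurable]
  rfl

theorem integrable_momentMeasure (b : Module.Basis (Fin k × Fin 2) ℝ V) {F : spDual B → ℂ}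
    (hF : Continuous F) (h : Integrable (fun v => F (moment B v)) b.addHaar) :
    Integrable F (momentMeasure B b) := by
  rw [momentMeasure_eq]
  refine Integrable.smul_measure ?_ (by simp)
  exact (integrable_map_measure hF.aestronglyMeasurable
    continuous_moment.measurable.aemeasurable).2 h

theorem integral_momentMeasure (b : Module.Basis (Fin k × Fin 2) ℝ V) {F : spDual B → ℂ}
    (hF : Continuous F) :
    ∫ f, F f ∂(momentMeasure B b) = (1 / 2) * ∫ v, F (moment B v) ∂b.addHaar := by
  rw [momentMeasure_eq, integral_smul_measure,
    integral_map continuous_moment.measurable.aemeasurable hF.aestronglyMeasurable]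
  simp

end Oscillatory

end SpOrbit

end

theorem mainTheorem10 {V : Type*} [NormedAddCommGroup V] [NormedSpace ℝ V]
    [FiniteDimensional ℝ V] [Nontrivial V] [MeasurableSpace V] [BorelSpace V]
    (B : LinearMap.BilinForm ℝ V) (hB : B.IsAlt) (hnd : B.Nondegenerate)
    (ι : ℂ) (hι : ι ^ 2 = -1) :
    -- the set `Ω` is a minimal nilpotent coadjoint orbit
    SpOrbit.IsMinimalNilpotentOrbit (SpOrbit.momentOrbit B) ∧
    -- the moment map is a double cover of `Ω` by `V \ {0}`
    (SpOrbit.moment B ⁻¹' SpOrbit.momentOrbit B = {0}ᶜ ∧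
      IsCoveringMap ((SpOrbit.momentOrbit B).restrictPreimage (SpOrbit.moment B)) ∧
      ∀ f ∈ SpOrbit.momentOrbit B, (SpOrbit.moment B ⁻¹' {f}).ncard = 2) ∧
    -- it pulls the symplectic form of `Ω` back to `B`
    (∀ v : V, v ≠ 0 → ∀ a b : V,
      SpOrbit.kksForm (SpOrbit.moment B v) (fderiv ℝ (SpOrbit.moment B) v a)
        (fderiv ℝ (SpOrbit.moment B) v b) = B a b) ∧
    -- `Ω` is a submanifold of dimension `dim V`, with a well-defined Liouville measure
    ((∀ f ∈ SpOrbit.momentOrbit B,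
        ∃ (U : Set (Fin (SpOrbit.halfDim V) × Fin 2 → ℝ))
          (φ : (Fin (SpOrbit.halfDim V) × Fin 2 → ℝ) → SpOrbit.spDual B),
          SpOrbit.IsLocalParam (SpOrbit.momentOrbit B) U φ ∧ f ∈ φ '' U) ∧
      ∀ (U : Set (Fin (SpOrbit.halfDim V) × Fin 2 → ℝ))
        (φ : (Fin (SpOrbit.halfDim V) × Fin 2 → ℝ) → SpOrbit.spDual B),
        SpOrbit.IsLocalParam (SpOrbit.momentOrbit B) U φ →
        (SpOrbit.orbitLiouville B (SpOrbit.halfDim V) (SpOrbit.momentOrbit B)).restrict (φ '' U)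
          = SpOrbit.chartLiouville B U φ) ∧
    -- the superPfaffian and `2 F_Ω` are the same generalized function on `sp(V)`
    (∃ b : Module.Basis (Fin (SpOrbit.halfDim V) × Fin 2) ℝ V, SpOrbit.IsSymplecticBasis B b) ∧
    ∀ (lam : MeasureTheory.Measure (SpOrbit.sp B)) [lam.IsAddHaarMeasure],
      ∃ T : 𝓓((⊤ : TopologicalSpace.Opens (SpOrbit.sp B)), ℂ) →L[ℂ] ℂ,
        ∀ ψ : 𝓓((⊤ : TopologicalSpace.Opens (SpOrbit.sp B)), ℂ),
          MeasureTheory.Integrable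
            (fun f : SpOrbit.spDual B =>
              ∫ X, ψ X * Complex.exp (ι * ((f X : ℝ) : ℂ)) ∂lam)
            (SpOrbit.orbitLiouville B (SpOrbit.halfDim V) (SpOrbit.momentOrbit B)) ∧
          T ψ = 2 * SpOrbit.fourierOrbit ι B (SpOrbit.halfDim V) (SpOrbit.momentOrbit B) lam ψ ∧
          ∀ b : Module.Basis (Fin (SpOrbit.halfDim V) × Fin 2) ℝ V,
            SpOrbit.IsSymplecticBasis B b →
            MeasureTheory.Integrable
              (fun v : V => ∫ X : SpOrbit.sp B, ψ X *
                Complex.exp (-(ι / 2) * ((B v ((X : V →L[ℝ] V) v) : ℝ) : ℂ)) ∂lam)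
              (SpOrbit.liouville b) ∧
            SpOrbit.superPfaffian ι B b lam ψ = T ψ := by
  obtain ⟨b₀, hb₀⟩ := SpOrbit.exists_isSymplecticBasis hB hnd
  refine ⟨SpOrbit.isMinimalNilpotentOrbit_momentOrbit hB hnd,
    ⟨SpOrbit.moment_preimage_momentOrbit hB hnd, SpOrbit.isCoveringMap_moment hB hnd,
      fun f hf => SpOrbit.moment_fiber_ncard hB hnd hf⟩,
    fun v hv a b => ?_, ⟨fun f hf => ?_, fun U φ h =>
      SpOrbit.restrict_orbitLiouville_eq hB hnd hb₀ h⟩, ⟨b₀, hb₀⟩, fun lam _ => ?_⟩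
  · rw [(SpOrbit.hasFDerivAt_moment v).fderiv]
    exact SpOrbit.kksForm_momentDeriv hB hnd hv a b
  · obtain ⟨v, hv, rfl⟩ := SpOrbit.exists_moment_eq hf
    obtain ⟨u, hu⟩ := SpOrbit.exists_apply_eq_one hnd hv
    refine ⟨_, _, SpOrbit.isLocalParam_moment hB hnd u (SpOrbit.coordEquiv b₀),
      (SpOrbit.coordEquiv b₀).symm v, ?_, ?_⟩
    · simp [hu]
    · simp
  · obtain ⟨T, hT⟩ := SpOrbit.exists_distribution hB hnd hι lam b₀.addHaar
    have hF (ψ : 𝓓((⊤ : TopologicalSpace.Opens (SpOrbit.sp B)), ℂ)) :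
        Continuous (SpOrbit.dualFourier ι lam ψ) :=
      SpOrbit.continuous_dualFourier hι ψ.continuous ψ.hasCompactSupport
    have hfour (b : Module.Basis (Fin (SpOrbit.halfDim V) × Fin 2) ℝ V)
        (hb : SpOrbit.IsSymplecticBasis B b)
        (ψ : 𝓓((⊤ : TopologicalSpace.Opens (SpOrbit.sp B)), ℂ)) :
        2 * SpOrbit.fourierOrbit ι B (SpOrbit.halfDim V) (SpOrbit.momentOrbit B) lam ψ =
          ι ^ SpOrbit.halfDim V * ((((2 * Real.pi) ^ SpOrbit.halfDim V)⁻¹ : ℝ) *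
            ∫ v, SpOrbit.dualFourier ι lam ψ (SpOrbit.moment B v) ∂b.addHaar) := by
      rw [SpOrbit.fourierOrbit, SpOrbit.orbitLiouville_eq hB hnd hb]
      change 2 * (_ * (ι ^ SpOrbit.halfDim V * ∫ f, SpOrbit.dualFourier ι lam ψ f ∂_)) = _
      -- The factor `1/2` from the two sheets cancels the `2` in front of the Fourier transform.
      rw [SpOrbit.integral_momentMeasure b (hF ψ)]
      ring
    refine ⟨(ι ^ SpOrbit.halfDim V * (((2 * Real.pi) ^ SpOrbit.halfDim V)⁻¹ : ℝ)) • T,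
      fun ψ => ⟨?_, ?_, fun b hb => ?_⟩⟩
    · rw [SpOrbit.orbitLiouville_eq hB hnd hb₀]
      exact SpOrbit.integrable_momentMeasure b₀ (hF ψ) (hT ψ).1
    · rw [hfour b₀ hb₀, smul_apply, (hT ψ).2, smul_eq_mul, mul_assoc]
    · have heq : (fun v : V => ∫ X : SpOrbit.sp B, ψ X *
            Complex.exp (-(ι / 2) * ((B v ((X : V →L[ℝ] V) v) : ℝ) : ℂ)) ∂lam) =
          fun v => SpOrbit.dualFourier ι lam ψ (SpOrbit.moment B v) := by
        ext v
        refine MeasureTheory.integral_congr_ae (Filter.Eventually.of_forall fun X => ?_)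
        simp only [SpOrbit.moment_apply]
        congr 2
        push_cast
        ring
      obtain ⟨T', hT'⟩ := SpOrbit.exists_distribution hB hnd hι lam b.addHaar
      constructor
      · rw [heq]
        exact (hT' ψ).1.smul_measure ENNReal.ofReal_ne_top
      -- Independence of the basis: `hfour` for `b` and for `b₀` evaluates the same quantity `2
      -- F_Ω`, which involves no basis.
      · rw [SpOrbit.superPfaffian, heq, SpOrbit.liouville, MeasureTheory.integral_smul_measure,
          ENNReal.toReal_ofReal (by positivity), Complex.real_smul, ← hfour b hb, smul_apply,
          (hT ψ).2, smul_eq_mul, mul_assoc, ← hfour b₀ hb₀]
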